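/- **Setting.** Let $V$ be a finite-dimensional Euclidean space with inner product $\langle\cdot,\cdot\rangle$, $\Phi\subset V$ a reduced crystallographic root system spanning $V$, $\alpha^\vee=2\alpha/\langle\alpha,\alpha\rangle$ for $\alpha\in\Phi$, $\Delta=\{\alpha_1,\dots,\alpha_r\}$ a fundamental system, $\Phi_+$ and $\Phi_-=-\Phi_+$ the positive and negative roots, $\lambda_1,\dots,\lambda_r$ the fundamental weights ($\langle\alpha_i^\vee,\lambda_j\rangle=\delta_{ij}$), $\rho=\frac12\sum_{\alpha\in\Phi_+}\alpha$, $\operatorname{Ht}\alpha^\vee=\langle\rho,\alpha^\vee\rangle$, $W$ the Weyl group, $\Phi_w=\Phi_+\cap w^{-1}\Phi_-$ for $w\in W$, and $w_0$ the longest element of $W$ (maximal $|\Phi_w|$). Let $\operatorname{Aut}(\Gamma)$ be the group of automorphisms of the Dynkin diagram $\Gamma$, i.e. of the permutations of $\{1,\dots,r\}$ preserving the Cartan matrix, acting linearly on $V$ by permuting the simple roots. Let $\varpi_0\in\operatorname{Aut}(\Gamma)$ be the element with $-\mathrm{Id}=\varpi_0w_0$. For $1\le p\le r$ put $\Delta_p=\Delta\setminus\{\alpha_p\}$,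 $$\rho_p=\tfrac12\sum_{\alpha\in\Phi_+,\ \langle\lambda_p,\alpha\rangle=0}\alpha,\qquad c_p=2\langle\lambda_p-\rho_p,\alpha_p^\vee\rangle .$$ Let $\xi(s)=\pi^{-s/2}\Gamma(s/2)\zeta(s)$ (meromorphically continued). For $\lambda\in V\otimes\mathbb C$ and $T\in V$ (pairings extended complex-bilinearly) let $$\omega^G_{\mathbb Q}(\lambda;T)=\sum_{w\in W}e^{\langle w\lambda-\rho,T\rangle}\prod_{\alpha\in\Delta}\frac1{\langle w\lambda-\rho,\alpha^\vee\rangle}\prod_{\alpha\in\Phi_w}\frac{\xi(\langle\lambda,\alpha^\vee\rangle)}{\xi(\langle\lambda,\alpha^\vee\rangle+1)} .$$ For an ordering $\Delta_p=\{\beta_1,\dots,\beta_{r-1}\}$, put $s=\langle\lambda-\rho,\alpha_p^\vee\rangle$ and $$\omega^{G/P}_{\mathbb Q}(s;T)=\operatorname{Res}_{\langle\lambda-\rho,\beta_1^\vee\rangle=0}\cdots\operatorname{Res}_{\langle\lambda-\rho,\beta_{r-1}^\vee\rangle=0}\omega^G_{\mathbb Q}(\lambda;T),$$ $$F_p(s)=\prod_{\alpha\in\Phi_-}\xi\bigl(\langle\lambda_p,\alpha^\vee\rangle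 s+\operatorname{Ht}\alpha^\vee\bigr),\qquad Z_p(s;T)=F_p(s)\,\omega^{G/P}_{\mathbb Q}(s;T).$$ **Proposition (Functional equations).** The element $\varpi_0\in\operatorname{Aut}(\Gamma)$ exists, and for every $p$ and every $T\in V$, $Z_p(s;T)$ is a meromorphic function of $s\in\mathbb C$. As identities of meromorphic functions of $s$, whichever orderings are used to define the two sides, $$Z_p(-c_p-s;\varpi_0T)=Z_p(s;T),$$ and, for every $\varpi\in\operatorname{Aut}(\Gamma)$ that acts on $V$ by isometries (this is automatic if $\Phi$ is irreducible, or if the inner product is $\operatorname{Aut}(\Phi)$-invariant) and $q=\varpi p$, $$Z_p(s;T)=Z_q(s;\varpi T).$$ -/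

import Mathlib

open scoped RealInnerProductSpace

namespace WengZeta

noncomputable section

/-- The residue at `a` of a function holomorphic on a punctured neighbourhood of `a`: the limit of
the normalised contour integrals over small circles about `a` (which are eventually constant). -/
def residue (f : ℂ → ℂ) (a : ℂ) : ℂ :=
  Filter.limUnder (nhdsWithin (0 : ℝ) (Set.Ioi 0))
    (fun ε : ℝ => (2 * (Real.pi : ℂ) * Complex.I)⁻¹ * circleIntegral f a ε)

/-- The iterated residue `Res_{u_{β₁} = 0} ⋯ Res_{u_{βₘ} = 0} F` along a list `[β₁, …, βₘ]` of
coordinates (the residue in the last coordinate `βₘ` of the list is taken first), the remaining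
coordinates being those of `u`. -/
def iteratedResidue {κ : Type*} [DecidableEq κ] (F : (κ → ℂ) → ℂ) : List κ → (κ → ℂ) → ℂ
  | [], u => F u
  | β :: l, u => residue (fun t => iteratedResidue F l (Function.update u β t)) 0

variable {ι V N : Type*} [NormedAddCommGroup V] [InnerProductSpace ℝ V]
  [AddCommGroup N] [Module ℝ N] {P : RootPairing ι ℝ V N}

/-- The coroots are the ones of Euclidean geometry: `⟨v, α^∨⟩ = 2 ⟨v, α⟩ / ⟨α, α⟩`. -/
def IsEuclidean (P : RootPairing ι ℝ V N) : Prop :=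
  ∀ (i : ι) (v : V), P.coroot' i v = 2 * ⟪v, P.root i⟫ / ⟪P.root i, P.root i⟫

/-- The fundamental weights, i.e. the basis of `V` dual to the basis of simple coroots. -/
def fundWeight [P.IsRootSystem] (b : P.Base) (j : b.support) : V :=
  P.toPerfPair.symm (b.toCoweightBasis.coord j)

open Classical in
theorem coroot'_fundWeight [P.IsRootSystem] (b : P.Base) (i j : b.support) :
    P.coroot' i (fundWeight b j) = if i = j then 1 else 0 := by
  have h : P.toLinearMap (fundWeight b j) = b.toCoweightBasis.coord j :=
    P.toPerfPair.apply_symm_apply _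
  change P.toLinearMap (fundWeight b j) (P.coroot i) = _
  rw [h, Module.Basis.coord_apply, RootPairing.Base.toCoweightBasis_repr_coroot,
    Finsupp.single_apply]

variable [Fintype ι]

open Classical in
/-- The Weyl vector, half the sum of the positive roots. -/
def weylVector (b : P.Base) : V :=
  (1 / 2 : ℝ) • ∑ i : ι with b.IsPos i, P.root i

/-- The height `⟨ρ, α^∨⟩` of a coroot. -/
def corootHeight (b : P.Base) (i : ι) : ℝ := P.coroot' i (weylVector b)

open Classical in
/-- The set `Φ_w` of positive roots made negative by `w`. -/
def inversionSet (b : P.Base) (w : P.weylGroup) : Finset ι :=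
  {i : ι | b.IsPos i ∧ ¬ b.IsPos (P.weylGroupToPerm w i)}

/-- The length of a Weyl group element. -/
def length (b : P.Base) (w : P.weylGroup) : ℕ := (inversionSet b w).card

theorem finite_weylGroup (P : RootPairing ι ℝ V N) [P.IsRootSystem] : Finite P.weylGroup := by
  refine Finite.of_injective (fun w : P.weylGroup => P.weylGroupToPerm w) ?_
  intro g h hgh
  apply Subtype.ext
  apply RootPairing.Equiv.weightHom_injective P
  apply LinearEquiv.toLinearMap_injective
  apply LinearMap.ext_on_range (RootPairing.IsRootSystem.span_root_eq_top (P := P))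
  intro i
  change g • P.root i = h • P.root i
  rw [RootPairing.weylGroup_apply_root, RootPairing.weylGroup_apply_root]
  exact congrArg (fun e : ι ≃ ι => P.root (e i)) hgh

theorem exists_longest [P.IsRootSystem] (b : P.Base) :
    ∃ w₀ : P.weylGroup, ∀ w, length b w ≤ length b w₀ :=
  haveI := finite_weylGroup P
  Finite.exists_max (length b)

/-- The longest element `w₀` of the Weyl group. -/
def longest [P.IsRootSystem] (b : P.Base) : P.weylGroup := (exists_longest b).choose

/-- Automorphisms of the Dynkin diagram, as permutations of the simple roots. -/
def IsDynkinAut [P.IsCrystallographic] (b : P.Base) (σ : Equiv.Perm b.support) : Prop :=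
  ∀ i j, b.cartanMatrix (σ i) (σ j) = b.cartanMatrix i j

/-- The linear automorphism of `V` induced by a permutation of the simple roots. -/
def permAct [P.IsRootSystem] (b : P.Base) (σ : Equiv.Perm b.support) : V ≃ₗ[ℝ] V :=
  b.toWeightBasis.equiv b.toWeightBasis σ

/-- The value at `λ = ∑ⱼ zⱼ λⱼ` in the complexification of `V` of the complex-linear extension of
a real linear functional `φ` on `V`. -/
def complexEval [P.IsRootSystem] (b : P.Base) (z : b.support → ℂ) (φ : V → ℝ) : ℂ :=
  ∑ j : b.support, z j * (φ (fundWeight b j) : ℂ)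

open Classical in
/-- The period `ω^G_ℚ(λ; T)` at `λ = ∑ⱼ zⱼ λⱼ`. The completed zeta function
`ξ(s) = π^{-s/2} Γ(s/2) ζ(s)` is `completedRiemannZeta`. -/
def period [P.IsRootSystem] (b : P.Base) (z : b.support → ℂ) (T : V) : ℂ :=
  letI := @Fintype.ofFinite P.weylGroup (finite_weylGroup P)
  ∑ w : P.weylGroup,
    Complex.exp (complexEval b z (fun v => ⟪w • v, T⟫) - (⟪weylVector b, T⟫ : ℝ))
      * (∏ i : b.support,
          1 / (complexEval b z (fun v => P.coroot' i (w • v)) - (corootHeight b i : ℂ)))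
      * ∏ i ∈ inversionSet b w,
          completedRiemannZeta (complexEval b z (fun v => P.coroot' i v))
            / completedRiemannZeta (complexEval b z (fun v => P.coroot' i v) + 1)

/-- `l` is an ordering of `Δ_p`, the set of simple roots other than `α_p`. -/
def IsOrdering {b : P.Base} (p : b.support) (l : List b.support) : Prop :=
  l.Nodup ∧ ∀ j, j ∈ l ↔ j ≠ p

open Classical in
/-- `ω^{G/P}_ℚ(s; T)`: the iterated residue of the period, taken along the hyperplanes
`⟨λ - ρ, β^∨⟩ = 0` for `β` in the ordering `l` of `Δ_p`, with `⟨λ - ρ, α_p^∨⟩ = s`. The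
coordinates are `u_j = ⟨λ - ρ, α_j^∨⟩`, i.e. `λ = ρ + ∑ⱼ u_j λⱼ`. -/
def omega [P.IsRootSystem] (b : P.Base) (p : b.support) (l : List b.support) (T : V) (s : ℂ) : ℂ :=
  iteratedResidue (fun u => period b (fun j => (corootHeight b j : ℂ) + u j) T) l (Pi.single p s)

open Classical in
/-- `F_p(s)`, the product of `ξ(⟨λ_p, α^∨⟩ s + Ht α^∨)` over the negative roots `α`. -/
def F [P.IsRootSystem] (b : P.Base) (p : b.support) (s : ℂ) : ℂ :=
  ∏ i : ι with ¬ b.IsPos i,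
    completedRiemannZeta ((P.coroot' i (fundWeight b p) : ℂ) * s + (corootHeight b i : ℂ))

/-- `Z_p(s; T) = F_p(s) ω^{G/P}_ℚ(s; T)`. -/
def Z [P.IsRootSystem] (b : P.Base) (p : b.support) (l : List b.support) (T : V) (s : ℂ) : ℂ :=
  F b p s * omega b p l T s

open Classical in
/-- `ρ_p`, half the sum of the positive roots normal to `λ_p`. -/
def rhoP [P.IsRootSystem] (b : P.Base) (p : b.support) : V :=
  (1 / 2 : ℝ) • ∑ i : ι with (b.IsPos i ∧ ⟪fundWeight b p, P.root i⟫ = 0), P.root i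

/-- The constant `c_p = 2 ⟨λ_p - ρ_p, α_p^∨⟩`. -/
def c [P.IsRootSystem] (b : P.Base) (p : b.support) : ℝ :=
  2 * P.coroot' p (fundWeight b p - rhoP b p)

end

end WengZeta

/-! Off a codiscrete set of `s`, the iterated residue can be computed term by term. Put `λ = ρ + ∑
u_j λ_j`. A Weyl element `w` contributes a pole along `u_j = 0`, with `j ≠ p`, from the first
product when `w α_j` is simple, and from `ξ` at `1` when `w α_j` is negative. These cases exclude
each other, so all poles are simple and the period is `∏_{j ≠ p} u_j⁻¹` times a function analytic
near `u = s e_p` (`period_eq_prod_inv_mul`, `analyticAt_regTerm`). Every ordering therefore gives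
the value of that function at `s e_p` (`iteratedResidue_eq_of_eq_prod_inv_mul`), and only those `w`
with `w Δ_p ⊆ Δ ∪ Φ₋` survive.

By `ξ(1 - z) = ξ(z)`, the factor `F_p` cancels the denominators `ξ(⟨λ, α^∨⟩ + 1)`
(`F_mul_prod_inversionSet`). Hence `Z_p` agrees with the finite sum `explicitZ`, whose terms are
products of an exponential, inverses of affine functions and values of `ξ` along the line `ρ + s
λ_p`. This gives meromorphy.

Both functional equations are then the substitution `w ↦ A w B⁻¹` in that sum (`explicitZ_smul`).
Here `A` is an isometric automorphism fixing `ρ`, and `B` carries the line `ρ + s λ_p` to the line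
`ρ + (a + ε s) λ_q`. Diagram symmetries use `A = B = ϖ`. The equation under `s ↦ -c_p - s` uses `A =
-w₀⁻¹` and `B = -w_p`, with `w_p` longest in the parabolic subgroup of `Δ_p`. As `-w_p` fixes `ρ_p`,
negates `λ_p`, and `ρ = ρ_p + (c_p / 2) λ_p`, it sends `ρ` to `ρ - c_p λ_p` (`weylVector_sub_rhoP`,
`exists_negAut_mul_parabolic`). -/

namespace WengZeta

set_option linter.unusedSectionVars false

/-! ### Iterated residues at simple normal-crossing poles -/

section Residues

open Filter Topology Metric

/-- Cauchy's integral formula makes the normalised integral constant for all radii below `r`, so the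
limit defining the residue exists. -/
theorem residue_eq_of_eq_inv_mul {f g : ℂ → ℂ} {r : ℝ} (hr : 0 < r)
    (hg : DifferentiableOn ℂ g (ball 0 r))
    (hf : ∀ t ∈ ball (0 : ℂ) r, t ≠ 0 → f t = t⁻¹ * g t) : residue f 0 = g 0 := by
  refine Tendsto.limUnder_eq ?_
  refine Tendsto.congr' ?_ tendsto_const_nhds
  have hmem : Set.Ioo (0 : ℝ) r ∈ 𝓝[>] (0 : ℝ) := Ioo_mem_nhdsGT hr
  filter_upwards [hmem] with ε hε
  have hsub : closedBall (0 : ℂ) ε ⊆ ball 0 r := closedBall_subset_ball hε.2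
  have hint : circleIntegral f 0 ε = ∮ z in C(0, ε), (z - 0)⁻¹ • g z := by
    refine circleIntegral.integral_congr hε.1.le fun z hz => ?_
    have hz0 : z ≠ 0 := by
      rintro rfl
      simp only [mem_sphere, dist_self] at hz
      exact hε.1.ne hz
    rw [hf z (hsub (sphere_subset_closedBall hz)) hz0, sub_zero, smul_eq_mul]
  have hd : DiffContOnCl ℂ g (ball 0 ε) := (hg.mono hsub).diffContOnCl_ball subset_rfl
  rw [hint, hd.circleIntegral_sub_inv_smul (mem_ball_self hε.1), smul_eq_mul, ← mul_assoc,
    inv_mul_cancel₀ Complex.two_pi_I_ne_zero, one_mul]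

variable {κ : Type*} [Fintype κ] [DecidableEq κ]

theorem update_mem_ball {u u₀ : κ → ℂ} {r : ℝ} {β : κ} {t : ℂ} (hu : u ∈ ball u₀ r)
    (ht : t ∈ ball (u₀ β) r) : Function.update u β t ∈ ball u₀ r := by
  have hr : 0 < r := pos_of_mem_ball hu
  rw [mem_ball, dist_pi_lt_iff hr] at hu ⊢
  intro j
  rcases eq_or_ne j β with rfl | h
  · simpa using ht
  · simpa [h] using hu j

theorem zeroOut_mem_ball {u u₀ : κ → ℂ} {r : ℝ} {l : List κ} (hu : u ∈ ball u₀ r)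
    (hl : ∀ j ∈ l, u₀ j = 0) : (fun j => if j ∈ l then 0 else u j) ∈ ball u₀ r := by
  have hr : 0 < r := pos_of_mem_ball hu
  rw [mem_ball, dist_pi_lt_iff hr] at hu ⊢
  intro j
  by_cases h : j ∈ l
  · simp [h, hl j h, hr]
  · simpa [h] using hu j

/-- Iterated residue of a function whose only singularities are simple poles along the coordinate
hyperplanes indexed by `M`. -/
theorem iteratedResidue_eq_of_eq_prod_inv_mul {F G : (κ → ℂ) → ℂ} {u₀ : κ → ℂ} {r : ℝ}
    {M : Finset κ} (hM : ∀ j ∈ M, u₀ j = 0) (hG : DifferentiableOn ℂ G (ball u₀ r))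
    (hF : ∀ u ∈ ball u₀ r, (∀ j ∈ M, u j ≠ 0) → F u = (∏ j ∈ M, (u j)⁻¹) * G u)
    (l : List κ) (hl : l.Nodup) (hlM : ∀ j ∈ l, j ∈ M) (u : κ → ℂ) (hu : u ∈ ball u₀ r)
    (hu0 : ∀ j ∈ M \ l.toFinset, u j ≠ 0) :
    iteratedResidue F l u =
      (∏ j ∈ M \ l.toFinset, (u j)⁻¹) * G (fun j => if j ∈ l then 0 else u j) := by
  induction l generalizing u with
  | nil => simpa [iteratedResidue] using hF u hu (by simpa using hu0)
  | cons β l ih =>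
    have hr : 0 < r := pos_of_mem_ball hu
    obtain ⟨hβ, hl'⟩ := List.nodup_cons.mp hl
    have hβM : β ∈ M := hlM β (by simp)
    have hlM' : ∀ j ∈ l, j ∈ M := fun j hj => hlM j (by simp [hj])
    have hsplit : M \ l.toFinset = insert β (M \ (β :: l).toFinset) := by
      ext j
      by_cases h : j = β
      · subst h; simp [hβM, hβ]
      · simp [h]
    have hnot : β ∉ M \ (β :: l).toFinset := by simp
    have hne : ∀ j ∈ M \ (β :: l).toFinset, j ≠ β := fun j hj h => hnot (h ▸ hj)
    -- Once the coordinates in `l` have been set to zero, the only singular factor in the variable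
    -- `β` is `t⁻¹`; `g` is what multiplies it.
    let g : ℂ → ℂ := fun t => (∏ j ∈ M \ (β :: l).toFinset, (u j)⁻¹) *
      G (fun j => if j ∈ l then 0 else Function.update u β t j)
    have hupd : ∀ t ∈ ball (0 : ℂ) r, Function.update u β t ∈ ball u₀ r := fun t ht =>
      update_mem_ball hu (by rwa [hM β hβM])
    have hg : DifferentiableOn ℂ g (ball 0 r) := by
      refine DifferentiableOn.const_mul (hG.comp (g := G) ?_ fun t ht =>
        zeroOut_mem_ball (hupd t ht) fun j hj => hM j (hlM' j hj)) _
      refine Differentiable.differentiableOn (differentiable_pi.mpr fun j => ?_)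
      by_cases hj : j ∈ l
      · simp [hj]
      · rcases eq_or_ne j β with rfl | h
        · simp [hj]
        · simp [hj, h]
    have hres := residue_eq_of_eq_inv_mul
      (f := fun t => iteratedResidue F l (Function.update u β t)) hr hg ?_
    · rw [iteratedResidue, hres]
      simp only [g]
      congr 2
      funext j
      by_cases hj : j ∈ l
      · simp [hj]
      · rcases eq_or_ne j β with rfl | h
        · simp
        · simp [hj, h]
    · intro t ht ht0
      have hprod : ∏ j ∈ M \ (β :: l).toFinset, (Function.update u β t j)⁻¹
          = ∏ j ∈ M \ (β :: l).toFinset, (u j)⁻¹ :=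
        Finset.prod_congr rfl fun j hj => by rw [Function.update_of_ne (hne j hj)]
      rw [ih hl' hlM' _ (hupd t ht), hsplit, Finset.prod_insert hnot, hprod,
        Function.update_self, mul_assoc]
      intro j hj
      rw [hsplit, Finset.mem_insert] at hj
      rcases hj with rfl | hj
      · simpa using ht0
      · rw [Function.update_of_ne (hne j hj)]
        exact hu0 j hj

end Residues

/-! ### Poles and zeros of the completed zeta function -/

section Xi

open Filter Topology

theorem analyticAt_completedRiemannZeta {s : ℂ} (h0 : s ≠ 0) (h1 : s ≠ 1) :
    AnalyticAt ℂ completedRiemannZeta s := by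
  rw [Complex.analyticAt_iff_eventually_differentiableAt]
  filter_upwards [isOpen_ne.mem_nhds h0, isOpen_ne.mem_nhds h1] with z hz0 hz1
  exact differentiableAt_completedZeta hz0 hz1

theorem completedRiemannZeta_ne_zero_of_one_lt_re {s : ℂ} (hs : 1 < s.re) :
    completedRiemannZeta s ≠ 0 := by
  have h0 : s ≠ 0 := by rintro rfl; simp at hs; linarith
  have h := riemannZeta_ne_zero_of_one_lt_re hs
  rw [riemannZeta_def_of_ne_zero h0] at h
  exact (div_ne_zero_iff.mp h).1

/-- The entire function `s (1 - s) ξ(s)`. -/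
noncomputable def entireXi (s : ℂ) : ℂ := s * (1 - s) * completedRiemannZeta₀ s - 1

theorem differentiable_entireXi : Differentiable ℂ entireXi := by
  have := differentiable_completedZeta₀
  unfold entireXi
  fun_prop

theorem completedRiemannZeta_eq_entireXi_div {s : ℂ} (h0 : s ≠ 0) (h1 : s ≠ 1) :
    completedRiemannZeta s = entireXi s / (s * (1 - s)) := by
  have h1' : 1 - s ≠ 0 := sub_ne_zero.mpr h1.symm
  rw [completedRiemannZeta_eq, entireXi]
  field_simp
  ring

/-- The entire function `s (1 - s) ξ(s)` takes the value `-1` at `0`, so its zeros are isolated. -/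
theorem eventually_codiscrete_completedRiemannZeta_ne_zero :
    ∀ᶠ s in codiscrete ℂ, completedRiemannZeta s ≠ 0 := by
  have hE : entireXi ⁻¹' {0}ᶜ ∈ codiscrete ℂ :=
    AnalyticOnNhd.preimage_zero_mem_codiscrete (x := 0)
      (fun z _ => differentiable_entireXi.analyticAt z) (by simp [entireXi])
  have hfin : ({0, 1} : Set ℂ)ᶜ ∈ codiscrete ℂ := (Set.toFinite _).compl_mem_codiscrete
  filter_upwards [hE, hfin] with s hs hs'
  simp only [Set.mem_compl_iff, Set.mem_insert_iff, Set.mem_singleton_iff, not_or,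
    Set.mem_preimage] at hs hs'
  rw [completedRiemannZeta_eq_entireXi_div hs'.1 hs'.2]
  exact div_ne_zero hs (mul_ne_zero hs'.1 (sub_ne_zero.mpr (Ne.symm hs'.2)))

theorem tendsto_affine_codiscrete {a : ℂ} (ha : a ≠ 0) (c : ℂ) :
    Tendsto (fun s : ℂ => a * s + c) (codiscrete ℂ) (codiscrete ℂ) := by
  let e : ℂ ≃ₜ ℂ := (Homeomorph.mulLeft₀ a ha).trans (Homeomorph.addRight c)
  intro S hS
  rw [mem_map, mem_codiscrete] at *
  intro x
  have h := hS (e x)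
  rw [disjoint_principal_right] at h ⊢
  have : Tendsto e (𝓝[≠] x) (𝓝[≠] (e x)) :=
    tendsto_nhdsWithin_of_tendsto_nhds_of_eventually_within _
      (e.continuous.continuousAt.mono_left nhdsWithin_le_nhds)
      (eventually_nhdsWithin_of_forall fun y hy => e.injective.ne hy)
  exact this h

theorem meromorphic_completedRiemannZeta_affine (a c : ℂ) :
    Meromorphic fun s : ℂ => completedRiemannZeta (a * s + c) := by
  have h : Meromorphic fun s : ℂ => completedRiemannZeta₀ (a * s + c) := fun s =>
    (((differentiable_completedZeta₀.comp
      (f := fun s : ℂ => a * s + c) (by fun_prop)).analyticAt s)).meromorphicAt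
  have h' : Meromorphic fun s : ℂ => a * s + c := fun s =>
    AnalyticAt.meromorphicAt (f := fun s : ℂ => a * s + c) (by fun_prop)
  have h1 : Meromorphic fun _ : ℂ => (1 : ℂ) := fun s => MeromorphicAt.const 1 s
  simp_rw [completedRiemannZeta_eq]
  exact (h.sub (h1.div h')).sub (h1.div (h1.sub h'))

/-- The regularisation `t ξ(1 + t)` at `t = 0`. -/
noncomputable def regXi : ℂ → ℂ :=
  Function.update (fun t => t * completedRiemannZeta (1 + t)) 0 1

theorem regXi_zero : regXi 0 = 1 := Function.update_self ..

theorem completedRiemannZeta_one_add {t : ℂ} (ht : t ≠ 0) :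
    completedRiemannZeta (1 + t) = t⁻¹ * regXi t := by
  rw [regXi, Function.update_of_ne ht, inv_mul_cancel_left₀ ht]

/-- Near `0` the function equals `-entireXi (1 + t) / (1 + t)`; its value `1` at the origin is the
residue of `ξ` at `1`. -/
theorem analyticAt_regXi : AnalyticAt ℂ regXi 0 := by
  have h : AnalyticAt ℂ (fun t : ℂ => -entireXi (1 + t) / (1 + t)) 0 := by
    refine AnalyticAt.div ?_ (by fun_prop) (by simp)
    exact (differentiable_entireXi.comp
      (f := fun t : ℂ => 1 + t) (by fun_prop)).neg.analyticAt 0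
  refine h.congr ?_
  have hne : ∀ᶠ t : ℂ in 𝓝 0, t ≠ -1 := isOpen_ne.mem_nhds (by simp)
  filter_upwards [hne] with t ht
  rcases eq_or_ne t 0 with rfl | h0
  · simp [regXi_zero, entireXi]
  · have h1 : 1 + t ≠ 0 := fun h => ht (by linear_combination h)
    rw [regXi, Function.update_of_ne h0,
      completedRiemannZeta_eq_entireXi_div h1 (by simpa using h0),
      show (1 + t) * (1 - (1 + t)) = -(t * (1 + t)) by ring, div_neg, mul_neg, neg_div]
    field_simp

end Xi

/-! ### Automorphisms of the root system, fundamental weights and heights -/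

section RootCombinatorics

variable {ι V N : Type*} [NormedAddCommGroup V] [InnerProductSpace ℝ V]
  [AddCommGroup N] [Module ℝ N] {P : RootPairing ι ℝ V N}

theorem smul_root (g : P.Aut) (i : ι) : g • P.root i = P.root (g • i) :=
  RootPairing.Hom.root_weightMap_apply _ _ _ _

theorem coroot'_smul_smul (g : P.Aut) (i : ι) (v : V) :
    P.coroot' (g • i) (g • v) = P.coroot' i v := by
  have h1 := RootPairing.Hom.coroot_coweightMap_apply P P (g • i) g.toHom
  have h2 := LinearMap.congr_fun
    (RootPairing.Hom.weight_coweight_transpose_apply P P (P.coroot (g • i)) g.toHom) v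
  have h3 : g.toHom.indexEquiv.symm (g • i) = i := g.toHom.indexEquiv.symm_apply_apply i
  rw [h1, h3] at h2
  exact h2

theorem coroot'_smul (g : P.Aut) (i : ι) (v : V) :
    P.coroot' i (g • v) = P.coroot' (g⁻¹ • i) v := by
  rw [← coroot'_smul_smul g (g⁻¹ • i) v, smul_inv_smul]

/-- The action of an automorphism of the root pairing on `V`, as a linear map. -/
noncomputable def autLin (g : P.Aut) : V →ₗ[ℝ] V := (RootPairing.Equiv.weightHom P g).toLinearMap

theorem autLin_apply (g : P.Aut) (v : V) : autLin g v = g • v := rfl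

theorem aut_smul_smul (g : P.Aut) (a : ℝ) (v : V) : g • (a • v) = a • g • v :=
  (autLin g).map_smul a v

theorem aut_ext [P.IsRootSystem] {g h : P.Aut} (H : ∀ v : V, g • v = h • v) : g = h :=
  RootPairing.Equiv.weightHom_injective P (LinearEquiv.ext H)

/-- The automorphism `-1` of a root system. -/
noncomputable def negAut (P : RootPairing ι ℝ V N) [Finite ι] [P.IsRootSystem] : P.Aut :=
  letI := P.indexNeg
  RootPairing.Equiv.mk' P P (LinearEquiv.neg ℝ) (Equiv.neg ι) (by intro i; simp)

theorem negAut_smul [Finite ι] [P.IsRootSystem] (v : V) : negAut P • v = -v := rfl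

theorem negAut_smul_index [Finite ι] [P.IsRootSystem] (i : ι) :
    negAut P • i = P.reflectionPerm i i := rfl

theorem coroot'_negAut [Finite ι] [P.IsRootSystem] (i : ι) (v : V) :
    P.coroot' (negAut P • i) v = -P.coroot' i v := by
  have h := coroot'_smul_smul (negAut P) i (-v)
  rwa [negAut_smul, neg_neg, map_neg] at h

theorem isPos_negAut_iff [Finite ι] [P.IsRootSystem] (b : P.Base) (i : ι) :
    b.IsPos (negAut P • i) ↔ ¬ b.IsPos i :=
  RootPairing.Base.IsPos.neg_iff_not b i

theorem negAut_mul_smul [Finite ι] [P.IsRootSystem] (g : P.Aut) (v : V) :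
    (negAut P * g) • v = -(g • v) := by
  rw [mul_smul, negAut_smul]

theorem negAut_inv [Finite ι] [P.IsRootSystem] : (negAut P)⁻¹ = negAut P := by
  rw [inv_eq_iff_mul_eq_one]
  refine aut_ext fun v => ?_
  rw [mul_smul, negAut_smul, negAut_smul, neg_neg, one_smul]

theorem negAut_mul_comm [Finite ι] [P.IsRootSystem] (g : P.Aut) :
    negAut P * g = g * negAut P := by
  refine aut_ext fun v => ?_
  rw [mul_smul, mul_smul, negAut_smul, negAut_smul, smul_neg]

theorem conj_reflection [P.IsRootSystem] (g : P.Aut) (i : ι) :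
    g * RootPairing.Equiv.reflection P i * g⁻¹ = RootPairing.Equiv.reflection P (g • i) := by
  refine aut_ext fun v => ?_
  rw [mul_smul, mul_smul, RootPairing.Equiv.reflection_smul, RootPairing.Equiv.reflection_smul,
    RootPairing.reflection_apply, RootPairing.reflection_apply, smul_sub, smul_inv_smul,
    aut_smul_smul, smul_root]
  congr 2
  change P.coroot' i (g⁻¹ • v) = P.coroot' (g • i) v
  rw [coroot'_smul, inv_inv]

/-- Normality of the Weyl group: conjugating a reflection gives the reflection in the transported
root. It lets a diagram automorphism permute the terms of the sum over `W`. -/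
theorem conj_mem_weylGroup [P.IsRootSystem] (g : P.Aut) {w : P.Aut} (hw : w ∈ P.weylGroup) :
    g * w * g⁻¹ ∈ P.weylGroup := by
  induction hw using RootPairing.weylGroup.induction with
  | mem i => rw [conj_reflection]; exact P.reflection_mem_weylGroup _
  | one => simp
  | mul x y hx hy h1 h2 =>
    have : g * (x * y) * g⁻¹ = (g * x * g⁻¹) * (g * y * g⁻¹) := by group
    rw [this]
    exact mul_mem h1 h2

/-! ### Fundamental weights and positive roots -/

theorem coroot'_eq_mul_of_isEuclidean (hP : IsEuclidean P) (i : ι) (v : V) :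
    P.coroot' i v * ⟪P.root i, P.root i⟫ = 2 * ⟪v, P.root i⟫ := by
  have h : ⟪P.root i, P.root i⟫ ≠ 0 := inner_self_ne_zero.mpr (P.ne_zero i)
  rw [hP, div_mul_cancel₀ _ h]

theorem inner_root_self_pos (i : ι) : 0 < ⟪P.root i, P.root i⟫ :=
  real_inner_self_pos.mpr (P.ne_zero i)

theorem inner_root_eq_zero_iff (hP : IsEuclidean P) (i : ι) (v : V) :
    ⟪v, P.root i⟫ = 0 ↔ P.coroot' i v = 0 := by
  have h := coroot'_eq_mul_of_isEuclidean hP i v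
  have h' := (inner_root_self_pos (P := P) i).ne'
  constructor
  · intro h0
    rw [h0, mul_zero] at h
    exact (mul_eq_zero.mp h).resolve_right h'
  · intro h0
    rw [h0, zero_mul] at h
    linarith

theorem inner_smul_smul_of_mem_weylGroup (hP : IsEuclidean P) {w : P.Aut} (hw : w ∈ P.weylGroup)
    (x y : V) : ⟪w • x, w • y⟫ = ⟪x, y⟫ := by
  induction hw using RootPairing.weylGroup.induction generalizing x y with
  | mem i =>
    have hx := coroot'_eq_mul_of_isEuclidean hP i x
    have hy := coroot'_eq_mul_of_isEuclidean hP i y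
    simp only [RootPairing.Equiv.reflection_smul, RootPairing.reflection_apply, inner_sub_left,
      inner_sub_right, real_inner_smul_left, real_inner_smul_right]
    rw [real_inner_comm y (P.root i)]
    linear_combination (1 / 2 : ℝ) * P.coroot' i y * hx + 1 / 2 * P.coroot' i x * hy
  | one => simp
  | mul g h _ _ h1 h2 => rw [mul_smul, mul_smul, h1, h2]

section Base

variable [P.IsRootSystem] (b : P.Base)

theorem sum_coroot'_smul_fundWeight (v : V) :
    ∑ j : b.support, P.coroot' j v • fundWeight b j = v := by
  classical
  apply P.toPerfPair.injective
  refine b.toCoweightBasis.ext fun i => ?_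
  rw [RootPairing.Base.toCoweightBasis_apply]
  change P.coroot' i _ = P.coroot' i v
  rw [map_sum]
  simp_rw [map_smul, coroot'_fundWeight, smul_eq_mul, mul_ite, mul_one, mul_zero]
  rw [Finset.sum_ite_eq Finset.univ i, if_pos (Finset.mem_univ i)]

theorem apply_eq_sum_fundWeight (φ : V →ₗ[ℝ] ℝ) (v : V) :
    φ v = ∑ j : b.support, P.coroot' j v * φ (fundWeight b j) := by
  conv_lhs => rw [← sum_coroot'_smul_fundWeight b v]
  simp [map_sum]

theorem eq_of_coroot'_eq {v v' : V} (h : ∀ j : b.support, P.coroot' j v = P.coroot' j v') :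
    v = v' := by
  rw [← sum_coroot'_smul_fundWeight b v, ← sum_coroot'_smul_fundWeight b v']
  simp_rw [h]

theorem exists_root_eq_sum_of_isPos {i : ι} (hi : b.IsPos i) :
    ∃ f : b.support → ℕ, P.root i = ∑ j : b.support, f j • P.root j := by
  obtain ⟨f, -, h | h⟩ := b.exists_root_eq_sum_nat_or_neg i
  · refine ⟨fun j => f j, h.trans ?_⟩
    exact (Finset.sum_coe_sort b.support fun j => f j • P.root j).symm
  · exfalso
    have h' : P.root i = ∑ j ∈ b.support, (-(f j : ℤ)) • P.root j := by
      rw [h, ← Finset.sum_neg_distrib]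
      exact Finset.sum_congr rfl fun j _ => by rw [neg_smul, natCast_zsmul]
    rw [RootPairing.Base.isPos_iff, RootPairing.Base.height_eq_sum h', Finset.sum_neg_distrib] at hi
    have : 0 ≤ ∑ j ∈ b.support, (f j : ℤ) := Finset.sum_nonneg fun j _ => by positivity
    linarith

theorem inner_fundWeight_root_nonneg (hP : IsEuclidean P) (j k : b.support) :
    0 ≤ ⟪fundWeight b j, P.root k⟫ := by
  classical
  have h := coroot'_eq_mul_of_isEuclidean hP (k : ι) (fundWeight b j)
  rw [coroot'_fundWeight] at h
  have h' := (inner_root_self_pos (P := P) k).le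
  split_ifs at h <;> linarith

/-- Positivity is defined through roots, and the Euclidean hypothesis transfers it to coroots, each
being a positive multiple of its root under the inner product. -/
theorem coroot'_fundWeight_nonneg (hP : IsEuclidean P) {i : ι} (hi : b.IsPos i) (j : b.support) :
    0 ≤ P.coroot' i (fundWeight b j) := by
  obtain ⟨f, hf⟩ := exists_root_eq_sum_of_isPos b hi
  rw [hP]
  refine div_nonneg (mul_nonneg zero_le_two ?_) (inner_root_self_pos i).le
  rw [hf, inner_sum]
  refine Finset.sum_nonneg fun k _ => ?_
  rw [← Nat.cast_smul_eq_nsmul ℝ, real_inner_smul_right]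
  exact mul_nonneg (Nat.cast_nonneg _) (inner_fundWeight_root_nonneg b hP j k)

theorem exists_int_coroot'_fundWeight (i : ι) :
    ∃ n : b.support → ℤ, ∀ j, P.coroot' i (fundWeight b j) = n j := by
  classical
  have key : ∀ f : ι → ℕ, ∀ j : b.support,
      P.toLinearMap (fundWeight b j) (∑ k ∈ b.support, f k • P.coroot k) = f j := by
    intro f j
    rw [← Finset.sum_coe_sort b.support fun k => f k • P.coroot k, map_sum]
    have : ∀ k : b.support, P.toLinearMap (fundWeight b j) (f k • P.coroot k)
        = f k * if k = j then 1 else 0 := by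
      intro k
      rw [map_nsmul, nsmul_eq_mul, ← coroot'_fundWeight b k j]
      rfl
    simp [this]
  obtain ⟨f, -, h | h⟩ := b.flip.exists_root_eq_sum_nat_or_neg i
  · refine ⟨fun j => f j, fun j => ?_⟩
    change P.toLinearMap (fundWeight b j) (P.coroot i) = _
    have h' : P.coroot i = ∑ k ∈ b.support, f k • P.coroot k := h
    rw [h', key]
    simp
  · refine ⟨fun j => -f j, fun j => ?_⟩
    change P.toLinearMap (fundWeight b j) (P.coroot i) = _
    have h' : P.coroot i = -∑ k ∈ b.support, f k • P.coroot k := h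
    rw [h', map_neg, key]
    simp

theorem exists_nat_coroot'_fundWeight (hP : IsEuclidean P) {i : ι} (hi : b.IsPos i) :
    ∃ n : b.support → ℕ, ∀ j, P.coroot' i (fundWeight b j) = n j := by
  obtain ⟨n, hn⟩ := exists_int_coroot'_fundWeight b i
  refine ⟨fun j => (n j).toNat, fun j => ?_⟩
  have h := coroot'_fundWeight_nonneg b hP hi j
  rw [hn] at h ⊢
  have h' : 0 ≤ n j := by exact_mod_cast h
  exact_mod_cast (Int.toNat_of_nonneg h').symm

end Base

/-! ### The Weyl vector and coroot heights -/

section WeylVector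

variable [Fintype ι] [P.IsRootSystem] [P.IsCrystallographic] [P.IsReduced] (b : P.Base)

/-- The reflection `s_j` permutes the summands and changes the sign of the pairing with `α_j^∨`. -/
theorem coroot'_sum_root_eq_zero {S : Finset ι} {j : ι}
    (hS : ∀ i ∈ S, P.reflectionPerm j i ∈ S) : P.coroot' j (∑ i ∈ S, P.root i) = 0 := by
  have h : ∑ i ∈ S, P.coroot' j (P.root i)
      = ∑ i ∈ S, P.coroot' j (P.root (P.reflectionPerm j i)) := by
    refine Finset.sum_bij' (fun i _ => P.reflectionPerm j i) (fun i _ => P.reflectionPerm j i)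
      hS hS ?_ ?_ ?_ <;> simp
  have h2 : ∀ i, P.coroot' j (P.root (P.reflectionPerm j i)) = -P.coroot' j (P.root i) := by
    intro i
    rw [RootPairing.root_coroot'_eq_pairing, RootPairing.root_coroot'_eq_pairing,
      ← RootPairing.pairing_reflectionPerm, RootPairing.pairing_reflectionPerm_self_right]
  simp_rw [h2, Finset.sum_neg_distrib] at h
  rw [map_sum]
  linarith

theorem smul_sum_root {S : Finset ι} (g : P.Aut) (hS : ∀ i ∈ S, g • i ∈ S) :
    g • ∑ i ∈ S, P.root i = ∑ i ∈ S, P.root i := by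
  classical
  rw [Finset.smul_sum]
  simp_rw [smul_root]
  have himg : S.image (g • ·) = S :=
    Finset.eq_of_subset_of_card_le (Finset.image_subset_iff.mpr hS)
      (Finset.card_image_of_injective _ (MulAction.injective g)).ge
  conv_rhs => rw [← himg, Finset.sum_image fun x _ y _ h => MulAction.injective g h]

/-- The reflection `s_j` permutes the positive roots other than `α_j`, so only `α_j / 2`
contributes. -/
theorem coroot'_weylVector (j : b.support) : P.coroot' j (weylVector b) = 1 := by
  classical
  have hj : (j : ι) ∈ ({i : ι | b.IsPos i} : Finset ι) := by
    simpa using RootPairing.Base.isPos_of_mem_support j.2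
  have h0 : P.coroot' j (∑ i ∈ ({i : ι | b.IsPos i} : Finset ι).erase j, P.root i) = 0 := by
    refine coroot'_sum_root_eq_zero fun i hi => ?_
    simp only [Finset.mem_erase, Finset.mem_filter, Finset.mem_univ, true_and] at hi ⊢
    refine ⟨fun h => ?_, hi.2.reflectionPerm j.2 hi.1⟩
    have h' : i = P.reflectionPerm j j := 
      (RootPairing.reflectionPerm_self ..).symm.trans (congrArg (P.reflectionPerm j) h)
    have := (isPos_negAut_iff b (j : ι)).mp (by rw [negAut_smul_index, ← h']; exact hi.2)
    exact this (RootPairing.Base.isPos_of_mem_support j.2)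
  rw [weylVector, map_smul, ← Finset.add_sum_erase _ _ hj, map_add, h0,
    RootPairing.root_coroot'_eq_pairing, RootPairing.pairing_same]
  norm_num

theorem corootHeight_simple (j : b.support) : corootHeight b j = 1 := coroot'_weylVector b j

theorem weylVector_eq_sum_fundWeight : weylVector b = ∑ j : b.support, fundWeight b j := by
  conv_lhs => rw [← sum_coroot'_smul_fundWeight b (weylVector b)]
  simp_rw [coroot'_weylVector, one_smul]

theorem corootHeight_eq_sum (i : ι) :
    corootHeight b i = ∑ j : b.support, P.coroot' i (fundWeight b j) := by
  rw [corootHeight, weylVector_eq_sum_fundWeight, map_sum]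

theorem corootHeight_negAut (i : ι) : corootHeight b (negAut P • i) = -corootHeight b i :=
  coroot'_negAut i _

/-- The height is the sum of the coordinates of the coroot, which are natural numbers. They cannot
all vanish because `⟨α, α^∨⟩ = 2`, and sum one forces a single coordinate one, hence a simple
coroot. -/
theorem exists_nat_corootHeight (hP : IsEuclidean P) {i : ι} (hi : b.IsPos i) :
    ∃ n : ℕ, 1 ≤ n ∧ corootHeight b i = n ∧ (n = 1 → i ∈ b.support) := by
  classical
  obtain ⟨n, hn⟩ := exists_nat_coroot'_fundWeight b hP hi
  refine ⟨∑ j, n j, ?_, by rw [corootHeight_eq_sum]; simp [hn], fun h1 => ?_⟩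
  · rw [Nat.one_le_iff_ne_zero]
    intro h0
    have h0' : ∀ j, n j = 0 := by simpa using h0
    have h2 : P.coroot' i (P.root i) = 2 := by
      rw [RootPairing.root_coroot'_eq_pairing, RootPairing.pairing_same]
    rw [apply_eq_sum_fundWeight b] at h2
    simp [hn, h0'] at h2
  · have hex : ∃ j, n j ≠ 0 := by
      by_contra! hc
      simp [hc] at h1
    obtain ⟨j, hj⟩ := hex
    have hsum := Finset.add_sum_erase Finset.univ n (Finset.mem_univ j)
    have hj1 : n j = 1 := by omega
    have hrest : ∑ k ∈ Finset.univ.erase j, n k = 0 := by omega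
    have hk : ∀ k, k ≠ j → n k = 0 := fun k hk =>
      Finset.sum_eq_zero_iff.mp hrest k (by simpa using hk)
    have heq : P.coroot' i = P.coroot' j := by
      ext v
      rw [apply_eq_sum_fundWeight b, Finset.sum_eq_single j]
      · simp [hn, hj1]
      · intro k _ hkj
        simp [hn, hk k hkj]
      · simp
    have : P.coroot i = P.coroot j := P.flip.toPerfPair.injective heq
    rw [P.coroot.injective this]
    exact j.2

theorem isPos_iff_corootHeight_pos (hP : IsEuclidean P) (i : ι) :
    b.IsPos i ↔ 0 < corootHeight b i := by
  have key : ∀ k, b.IsPos k → 0 < corootHeight b k := by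
    intro k hk
    obtain ⟨n, hn, h, -⟩ := exists_nat_corootHeight b hP hk
    rw [h]
    exact_mod_cast hn
  refine ⟨key i, fun h => ?_⟩
  by_contra hi
  have := key _ ((isPos_negAut_iff b i).mpr hi)
  rw [corootHeight_negAut] at this
  linarith

theorem corootHeight_eq_one_iff (hP : IsEuclidean P) (i : ι) :
    corootHeight b i = 1 ↔ i ∈ b.support := by
  refine ⟨fun h => ?_, fun h => corootHeight_simple b ⟨i, h⟩⟩
  have hi : b.IsPos i := by rw [isPos_iff_corootHeight_pos b hP, h]; exact one_pos
  obtain ⟨n, -, hn, hs⟩ := exists_nat_corootHeight b hP hi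
  rw [h] at hn
  exact hs (by exact_mod_cast hn.symm)

theorem corootHeight_smul (g : P.Aut) (hg : g • weylVector b = weylVector b) (i : ι) :
    corootHeight b (g • i) = corootHeight b i := by
  rw [corootHeight, corootHeight, ← coroot'_smul_smul g i, hg]

/-- `i` is the index of a simple root other than `α_p`. -/
def IsLeviSimple (b : P.Base) (p : b.support) (i : ι) : Prop := i ∈ b.support ∧ i ≠ p

/-- The right-hand side says that `⟨ρ + s λ_p, α^∨⟩` is identically `1` in `s`. In this form
membership in `Δ_p` is transported by any automorphism that maps one such line to another. -/
theorem isLeviSimple_iff (hP : IsEuclidean P) (p : b.support) (i : ι) :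
    IsLeviSimple b p i ↔ corootHeight b i = 1 ∧ P.coroot' i (fundWeight b p) = 0 := by
  classical
  rw [IsLeviSimple, corootHeight_eq_one_iff b hP]
  refine and_congr_right fun hi => ?_
  have h := coroot'_fundWeight b ⟨i, hi⟩ p
  simp only at h
  rw [h]
  simp [Subtype.ext_iff]

end WeylVector

end RootCombinatorics

/-! ### Longest elements of the Weyl group and of the maximal parabolic -/

section LongestElements

variable {ι V N : Type*} [Fintype ι] [NormedAddCommGroup V] [InnerProductSpace ℝ V]
  [AddCommGroup N] [Module ℝ N] {P : RootPairing ι ℝ V N}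
  [P.IsRootSystem] [P.IsCrystallographic] [P.IsReduced] (b : P.Base)

theorem weylGroupToPerm_apply (w : P.weylGroup) (i : ι) :
    P.weylGroupToPerm w i = (w : P.Aut) • i := rfl

theorem mem_inversionSet {w : P.weylGroup} {i : ι} :
    i ∈ inversionSet b w ↔ b.IsPos i ∧ ¬ b.IsPos ((w : P.Aut) • i) := by
  classical
  rw [inversionSet, Finset.mem_filter, weylGroupToPerm_apply]
  exact and_iff_right (Finset.mem_univ i)

theorem reflectionPerm_self_eq (i : ι) : P.reflectionPerm i i = negAut P • i := rfl

/-- The inversions of `w s_j` include the `s_j`-images of those of `w`, and also `α_j`, which is not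
among these images. -/
theorem length_lt_length_mul_reflection (w : P.weylGroup) {j : ι} (hj : j ∈ b.support)
    (hw : b.IsPos ((w : P.Aut) • j)) :
    length b w < length b (w * RootPairing.weylGroup.ofIdx P j) := by
  classical
  let S : Finset ι := (inversionSet b w).image (P.reflectionPerm j)
  have hpos : b.IsPos j := RootPairing.Base.isPos_of_mem_support hj
  have hneg : ¬ b.IsPos (P.reflectionPerm j j) := by
    rw [reflectionPerm_self_eq, isPos_negAut_iff, not_not]
    exact hpos
  have hjS : j ∉ S := by
    intro h
    obtain ⟨i, hi, h⟩ := Finset.mem_image.mp h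
    have h' : i = P.reflectionPerm j j :=
      (RootPairing.reflectionPerm_self ..).symm.trans (congrArg (P.reflectionPerm j) h)
    exact hneg (h' ▸ ((mem_inversionSet b).mp hi).1)
  have hmul : ∀ i, ((w * RootPairing.weylGroup.ofIdx P j : P.weylGroup) : P.Aut) • i
      = (w : P.Aut) • P.reflectionPerm j i := fun i => rfl
  have hsub : insert j S ⊆ inversionSet b (w * RootPairing.weylGroup.ofIdx P j) := by
    refine Finset.insert_subset ?_ fun k hk => ?_
    · rw [mem_inversionSet, hmul, reflectionPerm_self_eq]
      refine ⟨hpos, ?_⟩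
      rw [← mul_smul, ← negAut_mul_comm, mul_smul, isPos_negAut_iff, not_not]
      exact hw
    · obtain ⟨i, hi, rfl⟩ := Finset.mem_image.mp hk
      obtain ⟨hi1, hi2⟩ := (mem_inversionSet b).mp hi
      rw [mem_inversionSet, hmul, RootPairing.reflectionPerm_self]
      refine ⟨hi1.reflectionPerm hj ?_, hi2⟩
      rintro rfl
      exact hi2 hw
  have hcard := Finset.card_le_card hsub
  rw [Finset.card_insert_of_notMem hjS,
    Finset.card_image_of_injective _ (P.reflectionPerm j).injective] at hcard
  exact hcard

/-- If an automorphism makes the simple roots occurring in a positive root negative, then it makes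
that positive root negative. -/
theorem not_isPos_smul_of_forall (g : P.Aut) {i : ι} {f : b.support → ℕ}
    (hf : P.root i = ∑ j : b.support, f j • P.root j)
    (hg : ∀ j : b.support, f j ≠ 0 → ¬ b.IsPos (g • (j : ι))) : ¬ b.IsPos (g • i) := by
  classical
  -- `φ` is the linear height of a root: strictly positive on positive roots, nonpositive on the
  -- others.
  let φ : V →ₗ[ℝ] ℝ := ∑ j : b.support, b.toWeightBasis.coord j
  have hφ : ∀ j : b.support, φ (P.root j) = 1 := by
    intro j
    simp only [φ, LinearMap.sum_apply, Module.Basis.coord_apply,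
      RootPairing.Base.toWeightBasis_repr_root, Finsupp.single_apply]
    rw [Finset.sum_ite_eq, if_pos (Finset.mem_univ _)]
  have hpos : ∀ k, b.IsPos k → 0 ≤ φ (P.root k) := by
    intro k hk
    obtain ⟨f, hf⟩ := exists_root_eq_sum_of_isPos b hk
    rw [hf, map_sum]
    refine Finset.sum_nonneg fun j _ => ?_
    rw [map_nsmul, hφ]
    positivity
  have hpos' : ∀ k, b.IsPos k → 0 < φ (P.root k) := by
    intro k hk
    obtain ⟨f, hf⟩ := exists_root_eq_sum_of_isPos b hk
    refine lt_of_le_of_ne (hpos k hk) fun h0 => P.ne_zero k ?_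
    rw [hf, map_sum] at h0
    simp_rw [map_nsmul, hφ] at h0
    have h1 := (Finset.sum_eq_zero_iff_of_nonneg (fun j _ => by positivity)).mp h0.symm
    rw [hf]
    refine Finset.sum_eq_zero fun j hj => ?_
    have h2 : f j = 0 := by simpa using h1 j hj
    rw [h2, zero_smul]
  have hneg : ∀ k, ¬ b.IsPos k → φ (P.root k) ≤ 0 := by
    intro k hk
    have h := hpos _ ((isPos_negAut_iff b k).mpr hk)
    rw [← smul_root, negAut_smul, map_neg] at h
    linarith
  intro hi
  refine absurd (hpos' _ hi) (not_lt.mpr ?_)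
  rw [← smul_root, hf, Finset.smul_sum, map_sum]
  refine Finset.sum_nonpos fun j _ => ?_
  have h : g • f j • P.root j = f j • P.root (g • (j : ι)) := by
    rw [← smul_root]
    exact map_nsmul (autLin g) _ _
  rw [h, map_nsmul]
  by_cases h0 : f j = 0
  · simp [h0]
  · exact nsmul_nonpos (hneg _ (hg j h0)) _

theorem not_isPos_longest_smul {i : ι} (hi : b.IsPos i) :
    ¬ b.IsPos ((longest b : P.Aut) • i) := by
  obtain ⟨f, hf⟩ := exists_root_eq_sum_of_isPos b hi
  refine not_isPos_smul_of_forall b _ hf fun j _ hj => ?_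
  exact absurd (length_lt_length_mul_reflection b _ j.2 hj)
    (not_lt.mpr ((exists_longest b).choose_spec _))

theorem negAut_mul_longest_smul_weylVector :
    (negAut P * (longest b : P.Aut)) • weylVector b = weylVector b := by
  classical
  rw [weylVector, aut_smul_smul, smul_sum_root]
  intro i hi
  simp only [Finset.mem_filter, Finset.mem_univ, true_and] at hi ⊢
  rw [mul_smul, isPos_negAut_iff]
  exact not_isPos_longest_smul b hi

/-- With the inverse, `ϖ₀ w₀ = -1` is immediate, with no need to know that `w₀` is an involution. -/
theorem negAut_mul_longest_inv_smul_weylVector :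
    (negAut P * (longest b : P.Aut)⁻¹) • weylVector b = weylVector b := by
  have h := negAut_mul_longest_smul_weylVector b
  rw [negAut_mul_smul] at h
  rw [negAut_mul_smul, neg_eq_iff_eq_neg, inv_smul_eq_iff, smul_neg, h]

/-- The longest element of the parabolic subgroup attached to `Δ_p`, described as an element of the
stabiliser of `λ_p` making all roots of `Δ_p` negative. -/
theorem exists_longest_stabilizer (p : b.support) :
    ∃ w : P.weylGroup, w • fundWeight b p = fundWeight b p ∧
      ∀ j : b.support, j ≠ p → ¬ b.IsPos ((w : P.Aut) • (j : ι)) := by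
  classical
  have := finite_weylGroup P
  have : Nonempty {w : P.weylGroup // w • fundWeight b p = fundWeight b p} := ⟨⟨1, one_smul _ _⟩⟩
  obtain ⟨⟨w, hw⟩, hmax⟩ := Finite.exists_max
    fun w : {w : P.weylGroup // w • fundWeight b p = fundWeight b p} => length b w.1
  refine ⟨w, hw, fun j hj hpos => ?_⟩
  refine absurd (length_lt_length_mul_reflection b w j.2 hpos) (not_lt.mpr ?_)
  refine hmax ⟨w * RootPairing.weylGroup.ofIdx P j, ?_⟩
  -- For `j ≠ p` the reflection `s_j` fixes `λ_p`, so the longer element still lies in the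
  -- stabiliser.
  rw [mul_smul, RootPairing.weylGroup.ofIdx_smul, RootPairing.Equiv.reflection_smul,
    RootPairing.reflection_apply, coroot'_fundWeight, if_neg hj, zero_smul, sub_zero, hw]

variable (hP : IsEuclidean P) (p : b.support)
include hP

theorem sum_pos_eq_rhoP_add :
    weylVector b = rhoP b p + (1 / 2 : ℝ) • open Classical in
      ∑ i : ι with (b.IsPos i ∧ P.coroot' i (fundWeight b p) ≠ 0), P.root i := by
  classical
  rw [weylVector, rhoP, ← smul_add]
  simp_rw [inner_root_eq_zero_iff hP]
  congr 1
  rw [← Finset.sum_filter_add_sum_filter_not _ fun i => P.coroot' i (fundWeight b p) = 0,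
    Finset.filter_filter, Finset.filter_filter]

/-- The difference is half the sum of the positive roots not orthogonal to `λ_p`. This set is stable
under `s_j` for `j ≠ p`, so the sum pairs to zero with those `α_j^∨` and is a multiple of `λ_p`. The
coefficient is `c_p / 2` because `λ_p` and `ρ` both pair to `1` with `α_p^∨`. -/
theorem weylVector_sub_rhoP :
    weylVector b - rhoP b p = (c b p / 2) • fundWeight b p := by
  classical
  have hc : c b p = 2 * P.coroot' p (weylVector b - rhoP b p) := by
    rw [c, map_sub, map_sub, coroot'_fundWeight, if_pos rfl, coroot'_weylVector]
  refine eq_of_coroot'_eq b fun j => ?_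
  rw [map_smul, coroot'_fundWeight]
  by_cases h : j = p
  · rw [if_pos h, hc, h, smul_eq_mul]
    ring
  · rw [if_neg h, smul_zero, sum_pos_eq_rhoP_add b hP p, add_sub_cancel_left, map_smul,
      coroot'_sum_root_eq_zero, smul_zero]
    intro i hi
    simp only [Finset.mem_filter, Finset.mem_univ, true_and] at hi ⊢
    have hco : P.coroot' (P.reflectionPerm j i) (fundWeight b p)
        = P.coroot' i (fundWeight b p) := by
      rw [← RootPairing.coroot'_reflection, RootPairing.reflection_apply, coroot'_fundWeight,
        if_neg h, zero_smul, sub_zero]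
    rw [hco]
    refine ⟨hi.1.reflectionPerm j.2 ?_, hi.2⟩
    rintro rfl
    rw [coroot'_fundWeight, if_neg h] at hi
    exact hi.2 rfl

theorem exists_negAut_mul_parabolic :
    ∃ w : P.weylGroup, (negAut P * (w : P.Aut)) • fundWeight b p = -fundWeight b p ∧
      (negAut P * (w : P.Aut)) • weylVector b = weylVector b - c b p • fundWeight b p := by
  classical
  obtain ⟨w, hw, hneg⟩ := exists_longest_stabilizer b p
  have hw' : (w : P.Aut) • fundWeight b p = fundWeight b p := hw
  have hwinv : ∀ i, P.coroot' ((w : P.Aut) • i) (fundWeight b p)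
      = P.coroot' i (fundWeight b p) := by
    intro i
    conv_lhs => rw [← hw']
    rw [coroot'_smul_smul]
  have hB : (negAut P * (w : P.Aut)) • fundWeight b p = -fundWeight b p := by
    rw [negAut_mul_smul, hw']
  refine ⟨w, hB, ?_⟩
  have hrho : (negAut P * (w : P.Aut)) • rhoP b p = rhoP b p := by
    rw [rhoP, aut_smul_smul, smul_sum_root]
    intro i hi
    simp only [Finset.mem_filter, Finset.mem_univ, true_and, inner_root_eq_zero_iff hP] at hi ⊢
    rw [mul_smul, isPos_negAut_iff, coroot'_negAut, hwinv, hi.2, neg_zero]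
    refine ⟨?_, rfl⟩
    obtain ⟨f, hf⟩ := exists_root_eq_sum_of_isPos b hi.1
    -- A positive root orthogonal to `λ_p` cannot involve `α_p`: its inner product with `λ_p` is a
    -- sum of nonnegative terms, and the one for `α_p` would be nonzero.
    refine not_isPos_smul_of_forall b _ hf fun j hj => hneg j ?_
    rintro rfl
    have h0 := (inner_root_eq_zero_iff hP i (fundWeight b j)).mpr hi.2
    rw [hf, inner_sum] at h0
    have h1 := (Finset.sum_eq_zero_iff_of_nonneg fun k _ => ?_).mp h0 j (Finset.mem_univ _)
    · rw [← Nat.cast_smul_eq_nsmul ℝ, real_inner_smul_right, mul_eq_zero, Nat.cast_eq_zero,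
        inner_root_eq_zero_iff hP, coroot'_fundWeight, if_pos rfl] at h1
      exact h1.elim hj one_ne_zero
    · rw [← Nat.cast_smul_eq_nsmul ℝ, real_inner_smul_right]
      exact mul_nonneg (Nat.cast_nonneg _) (inner_fundWeight_root_nonneg b hP _ _)
  have hsplit : weylVector b = rhoP b p + (c b p / 2) • fundWeight b p := by
    rw [← weylVector_sub_rhoP b hP p]
    abel
  rw [hsplit, smul_add, hrho, aut_smul_smul, hB]
  module

end LongestElements

/-! ### The explicit formula and its meromorphy -/

section ExplicitFormula

variable {ι V N : Type*} [Fintype ι] [NormedAddCommGroup V] [InnerProductSpace ℝ V]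
  [AddCommGroup N] [Module ℝ N] {P : RootPairing ι ℝ V N}
  [P.IsRootSystem] [P.IsCrystallographic] [P.IsReduced]

/-- The pairing `⟨ρ + s λ_p, α^∨⟩`. -/
noncomputable def linePairing (b : P.Base) (p : b.support) (s : ℂ) (i : ι) : ℂ :=
  (P.coroot' i (fundWeight b p) : ℂ) * s + (corootHeight b i : ℂ)

open Classical in
/-- The contribution of `w` to `Z_p(s; T)` if `w Δ_p ⊆ Δ ∪ Φ₋`. -/
noncomputable def explicitTerm (b : P.Base) (p : b.support) (T : V) (s : ℂ) (w : P.Aut) : ℂ :=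
  Complex.exp ((⟪w • weylVector b, T⟫ : ℝ) + s * (⟪w • fundWeight b p, T⟫ : ℝ)
      - (⟪weylVector b, T⟫ : ℝ))
    * (∏ i : ι with (i ∈ b.support ∧ ¬ IsLeviSimple b p (w⁻¹ • i)),
        (linePairing b p s (w⁻¹ • i) - 1)⁻¹)
    * ∏ i : ι with (¬ b.IsPos (w • i) ∧ ¬ IsLeviSimple b p i),
        completedRiemannZeta (linePairing b p s i)

/-- The condition `w Δ_p ⊆ Δ ∪ Φ₋`. -/
def IsResidual (b : P.Base) (p : b.support) (w : P.Aut) : Prop :=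
  ∀ i, IsLeviSimple b p i → w • i ∈ b.support ∨ ¬ b.IsPos (w • i)

open Classical in
/-- The explicit formula for `Z_p(s; T)`. -/
noncomputable def explicitZ (b : P.Base) (p : b.support) (T : V) (s : ℂ) : ℂ :=
  let := @Fintype.ofFinite P.weylGroup (finite_weylGroup P)
  ∑ w : P.weylGroup, if IsResidual b p (w : P.Aut) then explicitTerm b p T s (w : P.Aut) else 0

theorem meromorphic_explicitZ (b : P.Base) (p : b.support) (T : V) :
    Meromorphic (explicitZ b p T) := by
  classical
  have hlin : ∀ i, Meromorphic fun s : ℂ => linePairing b p s i - 1 := fun i s =>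
    AnalyticAt.meromorphicAt (by unfold linePairing; fun_prop)
  have hterm : ∀ w, Meromorphic fun s : ℂ => explicitTerm b p T s w := by
    intro w s
    refine MeromorphicAt.mul (MeromorphicAt.mul ?_ ?_) ?_
    · exact AnalyticAt.meromorphicAt (by fun_prop)
    · exact MeromorphicAt.fun_prod fun i _ => (hlin _ s).inv
    · exact MeromorphicAt.fun_prod fun i _ => meromorphic_completedRiemannZeta_affine _ _ s
  intro s
  refine MeromorphicAt.fun_sum fun w _ => ?_
  split_ifs
  · exact hterm _ s
  · exact MeromorphicAt.const 0 s

/-! ### Invariance of the explicit formula under `w ↦ A w B⁻¹` -/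

section Symmetry

variable (b : P.Base) (hP : IsEuclidean P) {p q : b.support} {A B : P.Aut} {a ε : ℝ}
  (hε : ε ≠ 0)
  (hA : A • weylVector b = weylVector b) (hAinner : ∀ x y : V, ⟪A • x, A • y⟫ = ⟪x, y⟫)
  (hBρ : B • weylVector b = weylVector b + a • fundWeight b q)
  (hBp : B • fundWeight b p = ε • fundWeight b q)

include hBp in
theorem mul_coroot'_smul_fundWeight (i : ι) :
    ε * P.coroot' (B • i) (fundWeight b q) = P.coroot' i (fundWeight b p) := by
  rw [← smul_eq_mul, ← map_smul, ← hBp, coroot'_smul_smul]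

include hBρ in
theorem corootHeight_smul_add (i : ι) :
    corootHeight b (B • i) + a * P.coroot' (B • i) (fundWeight b q) = corootHeight b i := by
  rw [corootHeight, corootHeight, ← smul_eq_mul a, ← map_smul, ← map_add, ← hBρ,
    coroot'_smul_smul]

include hBρ hBp in
theorem linePairing_smul (s : ℂ) (i : ι) :
    linePairing b q (a + ε * s) (B • i) = linePairing b p s i := by
  rw [linePairing, linePairing, ← mul_coroot'_smul_fundWeight b hBp i,
    ← corootHeight_smul_add b hBρ i]
  push_cast
  ring

include hP hε hBρ hBp in
theorem isLeviSimple_smul_iff (i : ι) : IsLeviSimple b q (B • i) ↔ IsLeviSimple b p i := by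
  rw [isLeviSimple_iff b hP, isLeviSimple_iff b hP, ← mul_coroot'_smul_fundWeight b hBp i,
    ← corootHeight_smul_add b hBρ i, mul_eq_zero, or_iff_right hε]
  constructor
  · rintro ⟨h1, h2⟩
    rw [h2, mul_zero, add_zero]
    exact ⟨h1, rfl⟩
  · rintro ⟨h1, h2⟩
    rw [h2, mul_zero, add_zero] at h1
    exact ⟨h1, h2⟩

include hP hA in
-- An automorphism fixing `ρ` preserves coroot heights, and the simple roots are those of height
-- one.
theorem smul_mem_support_iff (i : ι) : A • i ∈ b.support ↔ i ∈ b.support := by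
  rw [← corootHeight_eq_one_iff b hP, ← corootHeight_eq_one_iff b hP, corootHeight_smul b A hA]

include hP hA in
theorem isPos_smul_iff (i : ι) : b.IsPos (A • i) ↔ b.IsPos i := by
  rw [isPos_iff_corootHeight_pos b hP, isPos_iff_corootHeight_pos b hP, corootHeight_smul b A hA]

theorem mul_mul_inv_smul (A w B : P.Aut) (i : ι) : (A * w * B⁻¹) • (B • i) = A • w • i := by
  rw [mul_smul, inv_smul_smul, mul_smul]

include hP hε hA hBρ hBp in
theorem isResidual_mul_mul_inv_iff (w : P.Aut) :
    IsResidual b q (A * w * B⁻¹) ↔ IsResidual b p w := by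
  constructor
  · intro h i hi
    have := h (B • i) ((isLeviSimple_smul_iff b hP hε hBρ hBp i).mpr hi)
    rwa [mul_mul_inv_smul, smul_mem_support_iff b hP hA, isPos_smul_iff b hP hA] at this
  · intro h i hi
    obtain ⟨k, rfl⟩ : ∃ k, B • k = i := ⟨B⁻¹ • i, smul_inv_smul _ _⟩
    rw [mul_mul_inv_smul, smul_mem_support_iff b hP hA, isPos_smul_iff b hP hA]
    exact h k ((isLeviSimple_smul_iff b hP hε hBρ hBp k).mp hi)

include hP hε hA hAinner hBρ hBp in
-- Since `B⁻¹` takes `ρ + (a + ε s) λ_q` back to `ρ + s λ_p` and `A` is an isometry fixing `ρ`, the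
-- exponents agree. The product over simple roots is reindexed by `A`, the product of `ξ`-values by
-- `B`.
theorem explicitTerm_mul_mul_inv (T : V) (s : ℂ) (w : P.Aut) :
    explicitTerm b q (A • T) (a + ε * s) (A * w * B⁻¹) = explicitTerm b p T s w := by
  classical
  have hBq : B⁻¹ • fundWeight b q = ε⁻¹ • fundWeight b p := by
    rw [inv_smul_eq_iff, aut_smul_smul, hBp, inv_smul_smul₀ hε]
  have hBρ' : B⁻¹ • weylVector b = weylVector b - (a * ε⁻¹) • fundWeight b p := by
    rw [inv_smul_eq_iff, smul_sub, hBρ, aut_smul_smul, hBp, smul_smul, inv_mul_cancel_right₀ hε,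
      add_sub_cancel_right]
  unfold explicitTerm
  congr 1
  · congr 1
    · congr 1
      have h1 : ⟪weylVector b, A • T⟫ = ⟪weylVector b, T⟫ := by
        conv_lhs => rw [← hA]
        exact hAinner _ _
      have h2 : ⟪(A * w * B⁻¹) • fundWeight b q, A • T⟫ = ε⁻¹ * ⟪w • fundWeight b p, T⟫ := by
        rw [mul_smul, hBq, mul_smul, hAinner, aut_smul_smul, real_inner_smul_left]
      have h3 : ⟪(A * w * B⁻¹) • weylVector b, A • T⟫
          = ⟪w • weylVector b, T⟫ - a * ε⁻¹ * ⟪w • fundWeight b p, T⟫ := by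
        rw [mul_smul, hBρ', mul_smul, hAinner, smul_sub, aut_smul_smul, inner_sub_left,
          real_inner_smul_left]
      have hε' : (ε : ℂ) ≠ 0 := by exact_mod_cast hε
      rw [h1, h2, h3]
      push_cast
      field_simp
      ring
    · symm
      have hinv : ∀ i : ι, (A * w * B⁻¹)⁻¹ • (A • i) = B • w⁻¹ • i := by
        intro i
        rw [mul_inv_rev, mul_inv_rev, inv_inv, mul_smul, mul_smul, inv_smul_smul]
      refine Finset.prod_equiv (MulAction.toPerm A) (fun i => ?_) fun i _ => ?_
      · simp only [Finset.mem_filter, Finset.mem_univ, true_and, MulAction.toPerm_apply]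
        rw [hinv, smul_mem_support_iff b hP hA, isLeviSimple_smul_iff b hP hε hBρ hBp]
      · rw [MulAction.toPerm_apply, hinv, linePairing_smul b hBρ hBp]
  · symm
    refine Finset.prod_equiv (MulAction.toPerm B) (fun i => ?_) fun i _ => ?_
    · simp only [Finset.mem_filter, Finset.mem_univ, true_and, MulAction.toPerm_apply]
      rw [mul_mul_inv_smul, isPos_smul_iff b hP hA, isLeviSimple_smul_iff b hP hε hBρ hBp]
    · rw [MulAction.toPerm_apply, linePairing_smul b hBρ hBp]

include hP hε hA hAinner hBρ hBp in
theorem explicitZ_smul (hW : ∀ w : P.Aut, w ∈ P.weylGroup ↔ A * w * B⁻¹ ∈ P.weylGroup)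
    (T : V) (s : ℂ) : explicitZ b q (A • T) (a + ε * s) = explicitZ b p T s := by
  classical
  let := @Fintype.ofFinite P.weylGroup (finite_weylGroup P)
  unfold explicitZ
  symm
  refine Fintype.sum_equiv
    (((Equiv.mulLeft A).trans (Equiv.mulRight B⁻¹)).subtypeEquiv hW) _ _ fun w => ?_
  change _ = if IsResidual b q (A * (w : P.Aut) * B⁻¹) then
    explicitTerm b q (A • T) (a + ε * s) (A * (w : P.Aut) * B⁻¹) else 0
  rw [explicitTerm_mul_mul_inv b hP hε hA hAinner hBρ hBp]
  simp only [isResidual_mul_mul_inv_iff b hP hε hA hBρ hBp]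

end Symmetry

end ExplicitFormula

/-! ### Computation of the iterated residue -/

section Residue

variable {ι V N : Type*} [Fintype ι] [NormedAddCommGroup V] [InnerProductSpace ℝ V]
  [AddCommGroup N] [Module ℝ N] {P : RootPairing ι ℝ V N}
  [P.IsRootSystem] [P.IsCrystallographic] [P.IsReduced] (b : P.Base) (p : b.support)

/-- The pairing `⟨λ, α^∨⟩` at `λ = ρ + ∑ⱼ u_j λⱼ`. -/
noncomputable def affPairing (u : b.support → ℂ) (i : ι) : ℂ :=
  (corootHeight b i : ℂ) + ∑ j : b.support, u j * (P.coroot' i (fundWeight b j) : ℂ)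

theorem complexEval_eq (u : b.support → ℂ) (φ : V →ₗ[ℝ] ℝ) :
    complexEval b (fun j => (corootHeight b j : ℂ) + u j) φ
      = (φ (weylVector b) : ℂ) + ∑ j : b.support, u j * (φ (fundWeight b j) : ℂ) := by
  rw [complexEval, weylVector_eq_sum_fundWeight, map_sum, Complex.ofReal_sum,
    ← Finset.sum_add_distrib]
  refine Finset.sum_congr rfl fun j _ => ?_
  rw [corootHeight_simple]
  push_cast
  ring

theorem complexEval_coroot' (u : b.support → ℂ) (i : ι) :
    complexEval b (fun j => (corootHeight b j : ℂ) + u j) (fun v => P.coroot' i v)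
      = affPairing b u i :=
  complexEval_eq b u (P.coroot' i)

theorem complexEval_coroot'_smul (u : b.support → ℂ) (w : P.weylGroup) (i : ι) :
    complexEval b (fun j => (corootHeight b j : ℂ) + u j) (fun v => P.coroot' i (w • v))
      = affPairing b u ((w : P.Aut)⁻¹ • i) := by
  rw [← complexEval_coroot']
  congr 1
  funext v
  exact coroot'_smul (w : P.Aut) i v

theorem complexEval_inner_smul (u : b.support → ℂ) (w : P.weylGroup) (T : V) :
    complexEval b (fun j => (corootHeight b j : ℂ) + u j) (fun v => ⟪w • v, T⟫)
      = (⟪(w : P.Aut) • weylVector b, T⟫ : ℝ)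
        + ∑ j : b.support, u j * (⟪(w : P.Aut) • fundWeight b j, T⟫ : ℝ) := by
  have h := complexEval_eq b u ((innerₗ V T).comp (autLin (w : P.Aut)))
  have h' : ∀ v, ((innerₗ V T).comp (autLin (w : P.Aut))) v = ⟪(w : P.Aut) • v, T⟫ := fun v =>
    real_inner_comm _ _
  simp_rw [h'] at h
  rw [← h]
  congr 1
  funext v
  exact (h' v).symm

theorem affPairing_simple (u : b.support → ℂ) (j : b.support) :
    affPairing b u j = 1 + u j := by
  classical
  rw [affPairing, corootHeight_simple]
  have h : ∀ k : b.support, u k * ((P.coroot' j (fundWeight b k) : ℝ) : ℂ)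
      = if j = k then u k else 0 := by
    intro k
    rw [coroot'_fundWeight]
    split_ifs <;> simp
  simp_rw [h]
  rw [Finset.sum_ite_eq, if_pos (Finset.mem_univ j), Complex.ofReal_one]

open Classical in
theorem affPairing_single (s : ℂ) (i : ι) :
    affPairing b (Pi.single p s) i = linePairing b p s i := by
  rw [affPairing, linePairing, Finset.sum_eq_single p]
  · rw [Pi.single_eq_same]
    ring
  · intro j _ hj
    rw [Pi.single_eq_of_ne hj, zero_mul]
  · simp

variable {p} in
theorem IsLeviSimple.isPos {i : ι} (h : IsLeviSimple b p i) : b.IsPos i :=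
  RootPairing.Base.isPos_of_mem_support h.1

variable {p} in
theorem IsLeviSimple.affPairing {i : ι} (h : IsLeviSimple b p i) (u : b.support → ℂ) :
    affPairing b u i = 1 + u ⟨i, h.1⟩ :=
  affPairing_simple b u ⟨i, h.1⟩

variable {p} in
theorem IsLeviSimple.linePairing {i : ι} (h : IsLeviSimple b p i) (s : ℂ) :
    linePairing b p s i = 1 := by
  classical
  rw [← affPairing_single, h.affPairing, Pi.single_eq_of_ne, add_zero]
  exact fun h' => h.2 (congrArg Subtype.val h')

open Classical in
theorem prod_erase_eq_prod_isLeviSimple (f : ι → ℂ) :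
    ∏ j ∈ Finset.univ.erase p, f (j : ι) = ∏ i : ι with IsLeviSimple b p i, f i := by
  refine Finset.prod_bij (fun j _ => (j : ι)) ?_ ?_ ?_ ?_
  · intro j hj
    simp only [Finset.mem_filter, Finset.mem_univ, true_and]
    exact ⟨j.2, fun h => (Finset.mem_erase.mp hj).1 (Subtype.ext h)⟩
  · exact fun i _ j _ h => Subtype.ext h
  · intro i hi
    simp only [Finset.mem_filter, Finset.mem_univ, true_and] at hi
    exact ⟨⟨i, hi.1⟩, Finset.mem_erase.mpr
      ⟨fun h => hi.2 (congrArg Subtype.val h), Finset.mem_univ _⟩, rfl⟩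
  · exact fun _ _ => rfl

open Classical in
/-- The contribution of `w` to the period, multiplied by the coordinates `u_j` with `j ≠ p`. -/
noncomputable def regTerm (T : V) (w : P.weylGroup) (u : b.support → ℂ) : ℂ :=
  Complex.exp ((⟪(w : P.Aut) • weylVector b, T⟫ : ℝ)
        + ∑ j : b.support, u j * (⟪(w : P.Aut) • fundWeight b j, T⟫ : ℝ) - (⟪weylVector b, T⟫ : ℝ))
    * (∏ i ∈ b.support, if IsLeviSimple b p ((w : P.Aut)⁻¹ • i) then 1 else
        (affPairing b u ((w : P.Aut)⁻¹ • i) - 1)⁻¹)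
    * (∏ i ∈ inversionSet b w, (if IsLeviSimple b p i then regXi (affPairing b u i - 1) else
        completedRiemannZeta (affPairing b u i)) / completedRiemannZeta (affPairing b u i + 1))
    * ∏ i : ι with IsLeviSimple b p i, if (w : P.Aut) • i ∈ b.support ∨ ¬ b.IsPos ((w : P.Aut) • i)
        then 1 else affPairing b u i - 1

open Classical in
theorem prod_support_eq (w : P.weylGroup) (f : ι → ℂ) :
    ∏ i ∈ b.support, f ((w : P.Aut)⁻¹ • i)
      = (∏ i ∈ b.support, if IsLeviSimple b p ((w : P.Aut)⁻¹ • i) then 1 else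
          f ((w : P.Aut)⁻¹ • i))
        * ∏ i : ι with IsLeviSimple b p i, if (w : P.Aut) • i ∈ b.support then f i else 1 := by
  have h : ∏ i : ι with IsLeviSimple b p i, (if (w : P.Aut) • i ∈ b.support then f i else 1)
      = ∏ i ∈ b.support, if IsLeviSimple b p ((w : P.Aut)⁻¹ • i) then f ((w : P.Aut)⁻¹ • i)
          else 1 := by
    rw [← Finset.prod_filter, ← Finset.prod_filter]
    refine Finset.prod_equiv (MulAction.toPerm (w : P.Aut)) (fun i => ?_) fun i _ => ?_
    · simp only [Finset.mem_filter, Finset.mem_univ, true_and, MulAction.toPerm_apply,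
        inv_smul_smul]
      exact and_comm
    · rw [MulAction.toPerm_apply, inv_smul_smul]
  rw [h, ← Finset.prod_mul_distrib]
  refine Finset.prod_congr rfl fun i _ => ?_
  split_ifs <;> simp

open Classical in
theorem prod_inversionSet_eq (w : P.weylGroup) (u : b.support → ℂ)
    (hu : ∀ i, IsLeviSimple b p i → affPairing b u i - 1 ≠ 0) :
    ∏ i ∈ inversionSet b w, completedRiemannZeta (affPairing b u i)
        / completedRiemannZeta (affPairing b u i + 1)
      = (∏ i ∈ inversionSet b w, (if IsLeviSimple b p i then regXi (affPairing b u i - 1) else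
          completedRiemannZeta (affPairing b u i)) / completedRiemannZeta (affPairing b u i + 1))
        * ∏ i : ι with IsLeviSimple b p i, if ¬ b.IsPos ((w : P.Aut) • i) then
            (affPairing b u i - 1)⁻¹ else 1 := by
  have h : ∏ i : ι with IsLeviSimple b p i, (if ¬ b.IsPos ((w : P.Aut) • i) then
        (affPairing b u i - 1)⁻¹ else 1)
      = ∏ i ∈ inversionSet b w, if IsLeviSimple b p i then (affPairing b u i - 1)⁻¹ else 1 := by
    rw [← Finset.prod_filter, ← Finset.prod_filter]
    refine Finset.prod_congr (Finset.ext fun i => ?_) fun _ _ => rfl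
    simp only [Finset.mem_filter, Finset.mem_univ, true_and, mem_inversionSet]
    exact ⟨fun h => ⟨⟨h.1.isPos b, h.2⟩, h.1⟩, fun h => ⟨h.2, h.1.2⟩⟩
  rw [h, ← Finset.prod_mul_distrib]
  refine Finset.prod_congr rfl fun i _ => ?_
  split_ifs with hi
  · have h1 := completedRiemannZeta_one_add (hu i hi)
    rw [add_sub_cancel] at h1
    rw [h1]
    ring
  · rw [mul_one]

open Classical in
-- All singular factors along `u_j = 0` are collected into one common product; a term that lacks the
-- pole in some direction is compensated by a factor `u_j` in `regTerm`.
theorem period_eq_prod_inv_mul (T : V) (u : b.support → ℂ)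
    (hu : ∀ j ∈ Finset.univ.erase p, u j ≠ 0) :
    letI := @Fintype.ofFinite P.weylGroup (finite_weylGroup P)
    period b (fun j => (corootHeight b j : ℂ) + u j) T
      = (∏ j ∈ Finset.univ.erase p, (u j)⁻¹) * ∑ w : P.weylGroup, regTerm b p T w u := by
  have hu' : ∀ i, IsLeviSimple b p i → affPairing b u i - 1 ≠ 0 := by
    intro i hi
    rw [hi.affPairing, add_sub_cancel_left]
    exact hu _ (by simpa using fun h => hi.2 (congrArg Subtype.val h))
  have hprod : ∏ j ∈ Finset.univ.erase p, (u j)⁻¹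
      = ∏ i : ι with IsLeviSimple b p i, (affPairing b u i - 1)⁻¹ := by
    rw [← prod_erase_eq_prod_isLeviSimple b p fun i => (affPairing b u i - 1)⁻¹]
    refine Finset.prod_congr rfl fun j _ => ?_
    rw [affPairing_simple, add_sub_cancel_left]
  rw [period, Finset.mul_sum, hprod]
  refine Finset.sum_congr rfl fun w _ => ?_
  simp_rw [complexEval_coroot', complexEval_coroot'_smul, complexEval_inner_smul,
    corootHeight_simple]
  have h1 : ∏ i : b.support, 1 / (affPairing b u ((w : P.Aut)⁻¹ • (i : ι)) - ((1 : ℝ) : ℂ))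
      = ∏ i ∈ b.support, (affPairing b u ((w : P.Aut)⁻¹ • i) - 1)⁻¹ := by
    rw [← Finset.prod_coe_sort b.support fun i => (affPairing b u ((w : P.Aut)⁻¹ • i) - 1)⁻¹]
    simp only [one_div, Complex.ofReal_one]
  -- Since a simple root is positive, `w α` is never both simple and negative, so each `α ∈ Δ_p`
  -- yields at most one inverse factor.
  have h2 : (∏ i : ι with IsLeviSimple b p i, if (w : P.Aut) • i ∈ b.support then
          (affPairing b u i - 1)⁻¹ else 1)
        * (∏ i : ι with IsLeviSimple b p i, if ¬ b.IsPos ((w : P.Aut) • i) then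
          (affPairing b u i - 1)⁻¹ else 1)
      = (∏ i : ι with IsLeviSimple b p i, (affPairing b u i - 1)⁻¹)
        * ∏ i : ι with IsLeviSimple b p i,
          if (w : P.Aut) • i ∈ b.support ∨ ¬ b.IsPos ((w : P.Aut) • i) then 1 else
            affPairing b u i - 1 := by
    rw [← Finset.prod_mul_distrib, ← Finset.prod_mul_distrib]
    refine Finset.prod_congr rfl fun i hi => ?_
    have h0 := hu' i (by simpa using hi)
    by_cases hs : (w : P.Aut) • i ∈ b.support
    · have hp := RootPairing.Base.isPos_of_mem_support hs
      simp [hs, hp]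
    · by_cases hp : b.IsPos ((w : P.Aut) • i)
      · simp [hs, hp, h0]
      · simp [hs, hp]
  rw [h1, prod_support_eq b p w fun i => (affPairing b u i - 1)⁻¹,
    prod_inversionSet_eq b p w u hu', regTerm]
  linear_combination (Complex.exp _ * (∏ i ∈ b.support, _) * (∏ i ∈ inversionSet b w, _)) * h2

/-- Values of `s` off the singular hyperplanes of the terms of the period. -/
def IsRegularValue (s : ℂ) : Prop :=
  (∀ i, ¬ IsLeviSimple b p i → linePairing b p s i ≠ 1) ∧
    ∀ i, b.IsPos i → linePairing b p s i ≠ 0 ∧ linePairing b p s i + 1 ≠ 0 ∧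
      completedRiemannZeta (linePairing b p s i + 1) ≠ 0

/-- Each condition bears on an affine function of `s`. With nonzero slope it excludes only a
discrete set. With slope zero the function is the constant height: it is `1` only for roots of
`Δ_p`, and for a positive root it is positive, so `ξ` is evaluated in the half-plane where it has no
zeros. -/
theorem eventually_isRegularValue (hP : IsEuclidean P) :
    ∀ᶠ s in Filter.codiscrete ℂ, IsRegularValue b p s := by
  have hne : ∀ z : ℂ, ∀ᶠ s in Filter.codiscrete ℂ, s ≠ z := fun z =>
    (Set.finite_singleton z).compl_mem_codiscrete
  refine Filter.Eventually.and ?_ ?_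
  · rw [Filter.eventually_all]
    intro i
    rw [Filter.eventually_imp_distrib_left]
    intro hi
    by_cases hc : P.coroot' i (fundWeight b p) = 0
    · refine Filter.Eventually.of_forall fun s h => hi ((isLeviSimple_iff b hP p i).mpr ⟨?_, hc⟩)
      rw [linePairing, hc, Complex.ofReal_zero, zero_mul, zero_add] at h
      exact_mod_cast h
    · exact (tendsto_affine_codiscrete (Complex.ofReal_ne_zero.mpr hc) _).eventually (hne 1)
  · rw [Filter.eventually_all]
    intro i
    rw [Filter.eventually_imp_distrib_left]
    intro hi
    by_cases hc : P.coroot' i (fundWeight b p) = 0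
    · refine Filter.Eventually.of_forall fun s => ?_
      have hpos := (isPos_iff_corootHeight_pos b hP i).mp hi
      rw [linePairing, hc, Complex.ofReal_zero, zero_mul, zero_add]
      refine ⟨by exact_mod_cast hpos.ne', by exact_mod_cast (by linarith : corootHeight b i + 1 ≠ 0),
        completedRiemannZeta_ne_zero_of_one_lt_re ?_⟩
      simpa using hpos
    · have hc' := Complex.ofReal_ne_zero.mpr hc
      have h1 := (tendsto_affine_codiscrete hc' (corootHeight b i : ℂ)).eventually (hne 0)
      have h2 := tendsto_affine_codiscrete hc' ((corootHeight b i : ℂ) + 1)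
      have h3 := h2.eventually (hne 0)
      have h4 := h2.eventually eventually_codiscrete_completedRiemannZeta_ne_zero
      filter_upwards [h1, h3, h4] with s hs1 hs3 hs4
      rw [linePairing, add_assoc]
      exact ⟨hs1, hs3, hs4⟩

open Classical in
theorem analyticAt_regTerm (T : V) (w : P.weylGroup) {s : ℂ} (hs : IsRegularValue b p s) :
    AnalyticAt ℂ (regTerm b p T w) (Pi.single p s) := by
  have hproj : ∀ j : b.support,
      AnalyticAt ℂ (fun u : b.support → ℂ => u j) (Pi.single p s) := fun j =>
    (ContinuousLinearMap.proj (R := ℂ) (φ := fun _ : b.support => ℂ) j).analyticAt _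
  have haff : ∀ i : ι, AnalyticAt ℂ (fun u => affPairing b u i) (Pi.single p s) := by
    intro i
    refine analyticAt_const.add (Finset.analyticAt_fun_sum _ fun j _ => ?_)
    exact (hproj j).mul analyticAt_const
  have hsub : ∀ i : ι, AnalyticAt ℂ (fun u => affPairing b u i - 1) (Pi.single p s) := fun i =>
    (haff i).sub analyticAt_const
  have hadd : ∀ i : ι, AnalyticAt ℂ (fun u => affPairing b u i + 1) (Pi.single p s) := fun i =>
    (haff i).add analyticAt_const
  refine AnalyticAt.mul (AnalyticAt.mul (AnalyticAt.mul ?_ ?_) ?_) ?_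
  · refine AnalyticAt.cexp' ((analyticAt_const.add
      (Finset.analyticAt_fun_sum _ fun j _ => ?_)).sub analyticAt_const)
    exact (hproj j).mul analyticAt_const
  · refine Finset.analyticAt_fun_prod _ fun i _ => ?_
    split_ifs with hi
    · exact analyticAt_const
    · refine (hsub _).inv ?_
      rw [affPairing_single]
      exact sub_ne_zero.mpr (hs.1 _ hi)
  · refine Finset.analyticAt_fun_prod _ fun i hi => ?_
    have hpos := ((mem_inversionSet b).mp hi).1
    obtain ⟨h0, h1, h2⟩ := hs.2 i hpos
    refine AnalyticAt.div ?_ ?_ ?_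
    · split_ifs with hi
      · refine AnalyticAt.fun_comp (g := regXi) ?_ (hsub i)
        rw [affPairing_single, hi.linePairing, sub_self]
        exact analyticAt_regXi
      · refine AnalyticAt.fun_comp (g := completedRiemannZeta) ?_ (haff i)
        rw [affPairing_single]
        exact analyticAt_completedRiemannZeta h0 (hs.1 i hi)
    · refine AnalyticAt.fun_comp (g := completedRiemannZeta) ?_ (hadd i)
      rw [affPairing_single]
      exact analyticAt_completedRiemannZeta h1 (by simpa using h0)
    · rwa [affPairing_single]
  · refine Finset.analyticAt_fun_prod _ fun i hi => ?_
    split_ifs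
    · exact analyticAt_const
    · exact hsub i

theorem linePairing_negAut (s : ℂ) (i : ι) :
    linePairing b p s (negAut P • i) = -linePairing b p s i := by
  rw [linePairing, linePairing, coroot'_negAut, corootHeight_negAut]
  push_cast
  ring

open Classical in
-- The negative roots split by the sign of `w α`. Those with `w α` positive are the negatives of
-- `Φ_w`, and `ξ(-z) = ξ(1 + z)` turns their factors into the denominators. Roots of `Δ_p` in `Φ_w`
-- leave only the residue `1` of `ξ`.
theorem F_mul_prod_inversionSet (w : P.weylGroup) {s : ℂ} (hs : IsRegularValue b p s) :
    F b p s * ∏ i ∈ inversionSet b w,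
        (if IsLeviSimple b p i then regXi (linePairing b p s i - 1) else
          completedRiemannZeta (linePairing b p s i))
            / completedRiemannZeta (linePairing b p s i + 1)
      = ∏ i : ι with (¬ b.IsPos ((w : P.Aut) • i) ∧ ¬ IsLeviSimple b p i),
          completedRiemannZeta (linePairing b p s i) := by
  have hF : F b p s = (∏ i : ι with (¬ b.IsPos i ∧ ¬ b.IsPos ((w : P.Aut) • i)),
        completedRiemannZeta (linePairing b p s i))
      * ∏ i ∈ inversionSet b w, completedRiemannZeta (linePairing b p s i + 1) := by
    rw [F, ← Finset.prod_filter_mul_prod_filter_not _ fun i => ¬ b.IsPos ((w : P.Aut) • i),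
      Finset.filter_filter, Finset.filter_filter]
    congr 1
    refine Finset.prod_equiv (MulAction.toPerm (negAut P)) (fun i => ?_) fun i _ => ?_
    · simp only [Finset.mem_filter, Finset.mem_univ, true_and, MulAction.toPerm_apply,
        mem_inversionSet, isPos_negAut_iff]
      rw [← mul_smul, ← negAut_mul_comm, mul_smul, isPos_negAut_iff]
    · rw [MulAction.toPerm_apply, linePairing_negAut, ← completedRiemannZeta_one_sub]
      congr 1
      rw [linePairing]
      ring
  have hR : ∏ i : ι with (¬ b.IsPos ((w : P.Aut) • i) ∧ ¬ IsLeviSimple b p i),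
        completedRiemannZeta (linePairing b p s i)
      = (∏ i : ι with (¬ b.IsPos i ∧ ¬ b.IsPos ((w : P.Aut) • i)),
          completedRiemannZeta (linePairing b p s i))
        * ∏ i ∈ inversionSet b w, if IsLeviSimple b p i then 1 else
            completedRiemannZeta (linePairing b p s i) := by
    rw [← Finset.prod_filter_mul_prod_filter_not _ fun i => ¬ b.IsPos i, Finset.filter_filter,
      Finset.filter_filter]
    congr 1
    · refine Finset.prod_congr (Finset.ext fun i => ?_) fun _ _ => rfl
      simp only [Finset.mem_filter, Finset.mem_univ, true_and]
      exact ⟨fun h => ⟨h.2, h.1.1⟩, fun h => ⟨⟨h.2, fun h' => h.1 (h'.isPos b)⟩, h.1⟩⟩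
    · simp_rw [← ite_not (IsLeviSimple b p _)]
      rw [← Finset.prod_filter]
      refine Finset.prod_congr (Finset.ext fun i => ?_) fun _ _ => rfl
      simp only [Finset.mem_filter, Finset.mem_univ, true_and, mem_inversionSet, not_not]
      tauto
  rw [hF, hR, mul_assoc, ← Finset.prod_mul_distrib]
  congr 1
  refine Finset.prod_congr rfl fun i hi => ?_
  have h0 := (hs.2 i ((mem_inversionSet b).mp hi).1).2.2
  rw [mul_div_cancel₀ _ h0]
  split_ifs with hi
  · rw [hi.linePairing, sub_self, regXi_zero]
  · rfl

open Classical in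
-- If some `α ∈ Δ_p` has `w α` positive but not simple, the term has no pole in that direction and
-- its compensating factor vanishes on the line.
theorem F_mul_regTerm (T : V) (w : P.weylGroup) {s : ℂ} (hs : IsRegularValue b p s) :
    F b p s * regTerm b p T w (Pi.single p s)
      = if IsResidual b p (w : P.Aut) then explicitTerm b p T s (w : P.Aut) else 0 := by
  have hsum : ∑ j : b.support, (Pi.single p s : b.support → ℂ) j
      * ((⟪(w : P.Aut) • fundWeight b j, T⟫ : ℝ) : ℂ)
      = s * (⟪(w : P.Aut) • fundWeight b p, T⟫ : ℝ) := by
    rw [Finset.sum_eq_single p]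
    · rw [Pi.single_eq_same]
    · intro j _ hj
      rw [Pi.single_eq_of_ne hj, zero_mul]
    · simp
  unfold regTerm
  simp_rw [hsum, affPairing_single]
  split_ifs with hw
  · have h1 : (∏ i : ι with IsLeviSimple b p i,
        if (w : P.Aut) • i ∈ b.support ∨ ¬ b.IsPos ((w : P.Aut) • i) then 1 else
          linePairing b p s i - 1) = 1 :=
      Finset.prod_eq_one fun i hi => if_pos (hw i (by simpa using hi))
    have h2 : (∏ i ∈ b.support, if IsLeviSimple b p ((w : P.Aut)⁻¹ • i) then 1 else
          (linePairing b p s ((w : P.Aut)⁻¹ • i) - 1)⁻¹)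
        = ∏ i : ι with (i ∈ b.support ∧ ¬ IsLeviSimple b p ((w : P.Aut)⁻¹ • i)),
          (linePairing b p s ((w : P.Aut)⁻¹ • i) - 1)⁻¹ := by
      rw [← Finset.filter_filter, Finset.filter_univ_mem, Finset.prod_filter]
      simp_rw [ite_not]
    rw [h1, h2, explicitTerm, ← F_mul_prod_inversionSet b p w hs]
    ring
  · have hw' : ∃ i, IsLeviSimple b p i ∧
        ¬ ((w : P.Aut) • i ∈ b.support ∨ ¬ b.IsPos ((w : P.Aut) • i)) := by
      simpa only [IsResidual, not_forall, exists_prop] using hw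
    obtain ⟨i, hi, hi'⟩ := hw'
    have h0 : (∏ i : ι with IsLeviSimple b p i,
        if (w : P.Aut) • i ∈ b.support ∨ ¬ b.IsPos ((w : P.Aut) • i) then 1 else
          linePairing b p s i - 1) = 0 :=
      Finset.prod_eq_zero (i := i) (by simpa using hi)
        (by rw [if_neg hi', hi.linePairing, sub_self])
    rw [h0, mul_zero, mul_zero]

theorem Z_eq_explicitZ {l : List b.support} (hl : IsOrdering p l) (T : V) {s : ℂ}
    (hs : IsRegularValue b p s) : Z b p l T s = explicitZ b p T s := by
  classical
  let := @Fintype.ofFinite P.weylGroup (finite_weylGroup P)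
  let G : (b.support → ℂ) → ℂ := fun u => ∑ w : P.weylGroup, regTerm b p T w u
  have hG : AnalyticAt ℂ G (Pi.single p s) :=
    Finset.analyticAt_fun_sum _ fun w _ => analyticAt_regTerm b p T w hs
  obtain ⟨r, hr, hball⟩ := Metric.eventually_nhds_iff_ball.mp hG.eventually_analyticAt
  have hres := iteratedResidue_eq_of_eq_prod_inv_mul
    (F := fun u => period b (fun j => (corootHeight b j : ℂ) + u j) T) (G := G)
    (u₀ := Pi.single p s) (r := r) (M := Finset.univ.erase p)
    (fun j hj => Pi.single_eq_of_ne (M := fun _ => ℂ) (Finset.mem_erase.mp hj).1 s)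
    (fun u hu => (hball u hu).differentiableAt.differentiableWithinAt)
    (fun u _ hu => period_eq_prod_inv_mul b p T u hu) l hl.1
    (fun j hj => Finset.mem_erase.mpr ⟨(hl.2 j).mp hj, Finset.mem_univ j⟩)
    (Pi.single p s) (Metric.mem_ball_self hr)
  -- An ordering exhausts `Δ_p`, so no inverse coordinate and no nonvanishing condition remains, and
  -- the formula applies at `s e_p` itself.
  have hempty : Finset.univ.erase p \ l.toFinset = ∅ := by
    ext j
    simp [hl.2 j]
  rw [hempty, Finset.prod_empty, one_mul] at hres
  have hres' : omega b p l T s = G (Pi.single p s) := by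
    rw [omega]
    refine Eq.trans (by convert! hres (by simp)) (congrArg G (funext fun j => ?_))
    split_ifs with hj
    · rw [Pi.single_eq_of_ne ((hl.2 j).mp hj)]
    · rfl
  rw [Z, hres', explicitZ, Finset.mul_sum]
  exact Finset.sum_congr rfl fun w _ => F_mul_regTerm b p T w hs

theorem Z_eventuallyEq_explicitZ (hP : IsEuclidean P) {l : List b.support} (hl : IsOrdering p l)
    (T : V) : Z b p l T =ᶠ[Filter.codiscrete ℂ] explicitZ b p T :=
  (eventually_isRegularValue b p hP).mono fun _ hs => Z_eq_explicitZ b p hl T hs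

end Residue

/-! ### Diagram automorphisms and the two functional equations -/

section FunctionalEquations

variable {ι V N : Type*} [Fintype ι] [NormedAddCommGroup V] [InnerProductSpace ℝ V]
  [AddCommGroup N] [Module ℝ N] {P : RootPairing ι ℝ V N}
  [P.IsRootSystem] [P.IsCrystallographic] [P.IsReduced] (b : P.Base)

theorem permAct_root (σ : Equiv.Perm b.support) (j : b.support) :
    permAct b σ (P.root j) = P.root (σ j) := by
  rw [permAct, ← RootPairing.Base.toWeightBasis_apply, Module.Basis.equiv_apply,
    RootPairing.Base.toWeightBasis_apply]

theorem permAct_eq_smul {σ : Equiv.Perm b.support} (A : P.Aut)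
    (hA : ∀ j : b.support, A • (j : ι) = σ j) (v : V) : permAct b σ v = A • v := by
  have h : (permAct b σ).toLinearMap = autLin A := by
    refine b.toWeightBasis.ext fun j => ?_
    rw [RootPairing.Base.toWeightBasis_apply, autLin_apply, smul_root, hA]
    exact permAct_root b σ j
  exact LinearMap.congr_fun h v

theorem isDynkinAut_of_smul {σ : Equiv.Perm b.support} (A : P.Aut)
    (hA : ∀ j : b.support, A • (j : ι) = σ j) : IsDynkinAut b σ := by
  intro i j
  have h : P.pairing (σ i) (σ j) = P.pairing i j := by
    rw [← hA, ← hA, ← RootPairing.root_coroot'_eq_pairing, ← smul_root, coroot'_smul_smul,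
      RootPairing.root_coroot'_eq_pairing]
  apply (algebraMap ℤ ℝ).injective_int
  rw [RootPairing.Base.algebraMap_cartanMatrixIn_apply,
    RootPairing.Base.algebraMap_cartanMatrixIn_apply, h]

theorem exists_aut_of_isDynkinAut {σ : Equiv.Perm b.support} (hσ : IsDynkinAut b σ) :
    ∃ A : P.Aut, ∀ j : b.support, A • (j : ι) = σ j := by
  refine ⟨RootPairing.Base.equivOfCartanMatrixEq b b σ hσ, fun j => P.root.injective ?_⟩
  rw [← smul_root, ← permAct_root]
  rfl

theorem smul_fundWeight {σ : Equiv.Perm b.support} (A : P.Aut)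
    (hA : ∀ j : b.support, A • (j : ι) = σ j) (p : b.support) :
    A • fundWeight b p = fundWeight b (σ p) := by
  classical
  refine eq_of_coroot'_eq b fun j => ?_
  obtain ⟨k, rfl⟩ := σ.surjective j
  rw [← hA, coroot'_smul_smul, hA, coroot'_fundWeight, coroot'_fundWeight]
  simp only [EmbeddingLike.apply_eq_iff_eq]

theorem smul_weylVector_of_perm {σ : Equiv.Perm b.support} (A : P.Aut)
    (hA : ∀ j : b.support, A • (j : ι) = σ j) : A • weylVector b = weylVector b := by
  refine eq_of_coroot'_eq b fun j => ?_
  obtain ⟨k, rfl⟩ := σ.surjective j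
  rw [coroot'_weylVector, ← hA, coroot'_smul_smul, coroot'_weylVector]

theorem exists_perm_of_smul_weylVector (hP : IsEuclidean P) (A : P.Aut)
    (hA : A • weylVector b = weylVector b) :
    ∃ σ : Equiv.Perm b.support, ∀ j : b.support, A • (j : ι) = σ j :=
  ⟨(MulAction.toPerm A).subtypePerm fun i => smul_mem_support_iff b hP hA i, fun _ => rfl⟩

/-- The functional equation for the opposition involution, for the explicit formula. -/
theorem explicitZ_opposition (hP : IsEuclidean P) (p : b.support) (T : V) (s : ℂ) :
    explicitZ b p ((negAut P * (longest b : P.Aut)⁻¹) • T) (-(c b p : ℂ) - s)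
      = explicitZ b p T s := by
  obtain ⟨w, hwp, hwρ⟩ := exists_negAut_mul_parabolic b hP p
  have h := explicitZ_smul b hP (p := p) (q := p) (A := negAut P * (longest b : P.Aut)⁻¹)
    (B := negAut P * (w : P.Aut)) (a := -c b p) (ε := -1) (by norm_num)
    (negAut_mul_longest_inv_smul_weylVector b) ?_ ?_ ?_ ?_ T s
  · rw [← h]
    congr 1
    push_cast
    ring
  · intro x y
    rw [negAut_mul_smul, negAut_mul_smul, inner_neg_neg]
    exact inner_smul_smul_of_mem_weylGroup hP (inv_mem (longest b).2) x y
  · rw [hwρ, neg_smul, sub_eq_add_neg]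
  · rw [hwp, neg_one_smul]
  · intro g
    -- Neither `A` nor `B` need lie in `W`, but `-1` is central of order dividing two, so the two
    -- signs cancel in `A g B⁻¹`.
    have hg : negAut P * (longest b : P.Aut)⁻¹ * g * (negAut P * (w : P.Aut))⁻¹
        = (longest b : P.Aut)⁻¹ * g * (w : P.Aut)⁻¹ := by
      rw [mul_inv_rev, negAut_inv, mul_assoc (negAut P), mul_assoc (negAut P), negAut_mul_comm]
      have h2 : negAut P * negAut P = 1 := by
        conv_lhs => lhs; rw [← negAut_inv]
        rw [inv_mul_cancel]
      simp only [mul_assoc, h2, mul_one]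
    rw [hg, Subgroup.mul_mem_cancel_right _ (inv_mem w.2),
      Subgroup.mul_mem_cancel_left _ (inv_mem (longest b).2)]

theorem explicitZ_perm (hP : IsEuclidean P) {σ : Equiv.Perm b.support} (hσ : IsDynkinAut b σ)
    (hiso : ∀ v : V, ‖permAct b σ v‖ = ‖v‖) (p : b.support) (T : V) (s : ℂ) :
    explicitZ b (σ p) (permAct b σ T) s = explicitZ b p T s := by
  obtain ⟨A, hA⟩ := exists_aut_of_isDynkinAut b hσ
  have hρ := smul_weylVector_of_perm b A hA
  have h := explicitZ_smul b hP (p := p) (q := σ p) (A := A) (B := A) (a := 0) (ε := 1)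
    one_ne_zero hρ ?_ ?_ ?_ ?_ T s
  · rw [permAct_eq_smul b A hA, ← h]
    congr 1
    push_cast
    ring
  · intro x y
    have hn := (LinearMap.norm_map_iff_inner_map_map (permAct b σ)).mp hiso x y
    rwa [permAct_eq_smul b A hA, permAct_eq_smul b A hA] at hn
  · rw [hρ, zero_smul, add_zero]
  · rw [smul_fundWeight b A hA, one_smul]
  · intro w
    refine ⟨conj_mem_weylGroup A, fun h => ?_⟩
    have h' := conj_mem_weylGroup A⁻¹ h
    rw [inv_inv] at h'
    convert h' using 1
    group

end FunctionalEquations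

end WengZeta

theorem mainTheorem3 {ι V N : Type*} [Fintype ι]
    [NormedAddCommGroup V] [InnerProductSpace ℝ V] [AddCommGroup N] [Module ℝ N]
    (P : RootPairing ι ℝ V N) [P.IsRootSystem] [P.IsCrystallographic] [P.IsReduced]
    (hP : WengZeta.IsEuclidean P) (b : P.Base) :
    (∀ (p : b.support) (l : List b.support), WengZeta.IsOrdering p l → ∀ T : V,
      Meromorphic (WengZeta.Z b p l T)) ∧
    (∃ ϖ₀ : Equiv.Perm b.support, WengZeta.IsDynkinAut b ϖ₀ ∧
      (∀ v : V, WengZeta.permAct b ϖ₀ (WengZeta.longest b • v) = -v) ∧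
      ∀ (p : b.support) (l l' : List b.support),
        WengZeta.IsOrdering p l → WengZeta.IsOrdering p l' → ∀ T : V,
          (fun s : ℂ => WengZeta.Z b p l' (WengZeta.permAct b ϖ₀ T) (-(WengZeta.c b p : ℂ) - s))
            =ᶠ[Filter.codiscrete ℂ] WengZeta.Z b p l T) ∧
    (∀ ϖ : Equiv.Perm b.support, WengZeta.IsDynkinAut b ϖ →
      (∀ v : V, ‖WengZeta.permAct b ϖ v‖ = ‖v‖) →
      ∀ (p q : b.support), q = ϖ p → ∀ (l l' : List b.support),
        WengZeta.IsOrdering p l → WengZeta.IsOrdering q l' → ∀ T : V,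
          WengZeta.Z b p l T
            =ᶠ[Filter.codiscrete ℂ] WengZeta.Z b q l' (WengZeta.permAct b ϖ T)) := by
  refine ⟨fun p l hl T => ?_, ?_, ?_⟩
  · exact (WengZeta.meromorphic_explicitZ b p T).congr_codiscrete
      (WengZeta.Z_eventuallyEq_explicitZ b p hP hl T).symm
  · obtain ⟨ϖ₀, hϖ₀⟩ := WengZeta.exists_perm_of_smul_weylVector b hP _
      (WengZeta.negAut_mul_longest_inv_smul_weylVector b)
    have hact := WengZeta.permAct_eq_smul b _ hϖ₀
    refine ⟨ϖ₀, WengZeta.isDynkinAut_of_smul b _ hϖ₀, fun v => ?_, fun p l l' hl hl' T => ?_⟩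
    · rw [hact, WengZeta.negAut_mul_smul]
      exact congrArg Neg.neg (inv_smul_smul (WengZeta.longest b : P.Aut) v)
    -- The explicit formula is also needed at the reflected point, so the exceptional set is pulled
    -- back along `s ↦ -c_p - s`.
    · have htend : Filter.Tendsto (fun s : ℂ => -(WengZeta.c b p : ℂ) - s)
          (Filter.codiscrete ℂ) (Filter.codiscrete ℂ) := by
        convert WengZeta.tendsto_affine_codiscrete (neg_ne_zero.mpr one_ne_zero)
          (-(WengZeta.c b p : ℂ)) using 2 with s
        ring
      filter_upwards [WengZeta.Z_eventuallyEq_explicitZ b p hP hl T,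
        htend.eventually (WengZeta.Z_eventuallyEq_explicitZ b p hP hl'
          (WengZeta.permAct b ϖ₀ T))] with s h h'
      rw [h, h', hact, WengZeta.explicitZ_opposition b hP]
  · rintro ϖ hϖ hiso p _ rfl l l' hl hl' T
    filter_upwards [WengZeta.Z_eventuallyEq_explicitZ b p hP hl T,
      WengZeta.Z_eventuallyEq_explicitZ b (ϖ p) hP hl' (WengZeta.permAct b ϖ T)] with s h h'
    rw [h, h', WengZeta.explicitZ_perm b hP hϖ hiso]
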